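/- Let $n\ge 2$, let $N$ be a compact smooth $(n-1)$-dimensional manifold, with or without boundary, let $-\infty\le a<b\le+\infty$ and let $M=(a,b)\times N$. Let $g=dr^2+G(r)$ be a smooth Riemannian metric on $M$, where $G(r)$, $r\in(a,b)$, is a family of Riemannian metrics on $N$, and let $g_0=dr^2+\mathring h(r)^2\hat G$ be a background warped product metric, where $\mathring h$ is a smooth positive function on $(a,b)$ and $\hat G$ is a fixed smooth Riemannian metric on $N$, with Riemannian measure $\mu_{\hat G}$. Let $H$ and $\mathring H$ be the mean curvatures (traces of the Weingarten map $X\mapsto\nabla_X\partial_r$) of the level sets $N(r)=\{r\}\times N$ relative to $g$ and $g_0$ respectively, and let $R_{rr}$ and $\mathring R_{rr}$ be the Ricci curvatures of $g$ and $g_0$ in the direction $(\partial_r,\partial_r)$. Define $$m(r,x)=\mathring h(r)^2\bigl(\mathring H(r,x)-H(r,x)\bigr),\qquad \mathcal M(r)=\int_N m(r,x)\,d\mu_{\hat G}(x).$$ Assume that the finite limits $\mathcal M(a)=\lim_{r\to a}\mathcal M(r)$ and $\mathcal M(b)=\lim_{r\to b}\mathcal M(r)$ exist and that $\mathring h^2(R_{rr}-\mathring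 R_{rr})\in L^1(M,dr\,d\mu_{\hat G})$. Then $$\mathcal M(b)-\mathcal M(a)\ \ge\ \int_M \mathring h^2(R_{rr}-\mathring R_{rr})\,dr\,d\mu_{\hat G},$$ and equality holds if and only if there is a fixed smooth Riemannian metric $\widetilde G$ on $N$ such that $G(r)=\mathring h(r)^2\widetilde G$ for all $r\in(a,b)$. If moreover $g$ is asymptotic to $g_0$ at some $r_0\in[a,b]$, meaning that the norm of the tensor $G(r)-\mathring h(r)^2\hat G$ with respect to $\mathring h(r)^2\hat G$ tends to $0$ uniformly on $N$ as $r\in(a,b)$ tends to $r_0$ (for $r_0\in(a,b)$: the two metrics coincide on $N(r_0)$), then equality holds if and only if $g=g_0$ on $M$. -/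

import Mathlib

open Set Filter Topology MeasureTheory
open scoped Manifold ContDiff ENNReal

noncomputable section

namespace RadialMass

section Charts

variable {V : Type*} [NormedAddCommGroup V] [NormedSpace ℝ V]
  {H : Type*} [TopologicalSpace H] (I : ModelWithCorners ℝ V H)
  {M : Type*} [TopologicalSpace M] [ChartedSpace H M]
  {ι : Type*} [Fintype ι] [DecidableEq ι] (b : Module.Basis ι ℝ V)

/-- The coordinate vector field `∂ᵢ` of the preferred chart around `p`, at the point of coordinates
`z`: the image of the `i`-th basis vector under the differential of the inverse chart. -/
def coordVec (p : M) (z : V) (i : ι) : TangentSpace I ((extChartAt I p).symm z) :=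
  mfderivWithin 𝓘(ℝ, V) I (extChartAt I p).symm (range I) z (b i)

/-- The matrix `g_{ij}` of a bilinear form on the tangent spaces, in the preferred chart around
`p`, at the point of coordinates `z`. -/
def coordMatrix (g : ∀ q : M, TangentSpace I q →L[ℝ] TangentSpace I q →L[ℝ] ℝ)
    (p : M) (z : V) : Matrix ι ι ℝ :=
  Matrix.of fun i j =>
    g ((extChartAt I p).symm z) (coordVec I b p z i) (coordVec I b p z j)

/-- The partial derivative `∂ᵢ f` in a chart. Derivatives are taken within the range of the model,
so that boundary points are allowed. -/
def coordDeriv (i : ι) (f : V → ℝ) (z : V) : ℝ :=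
  fderivWithin ℝ f (range I) z (b i)

/-- The Christoffel symbol `Γᵏᵢⱼ` of the metric `g` in the preferred chart around `p`, at the point
of coordinates `z`. -/
def christoffel (g : ∀ q : M, TangentSpace I q →L[ℝ] TangentSpace I q →L[ℝ] ℝ)
    (p : M) (k i j : ι) (z : V) : ℝ :=
  (1 / 2) * ∑ l, (coordMatrix I b g p z)⁻¹ k l *
    (coordDeriv I b i (fun y => coordMatrix I b g p y j l) z
      + coordDeriv I b j (fun y => coordMatrix I b g p y i l) z
      - coordDeriv I b l (fun y => coordMatrix I b g p y i j) z)

/-- The component `R_{ij}` at `p` of the Ricci tensor of the metric `g`, in the preferred chart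
around `p`. With this sign the round spheres have positive Ricci curvature. -/
def ricci (g : ∀ q : M, TangentSpace I q →L[ℝ] TangentSpace I q →L[ℝ] ℝ)
    (p : M) (i j : ι) : ℝ :=
  (∑ k, (coordDeriv I b k (christoffel I b g p k i j) (extChartAt I p p)
      - coordDeriv I b j (christoffel I b g p k i k) (extChartAt I p p)))
  + ∑ k, ∑ l,
      (christoffel I b g p k k l (extChartAt I p p) * christoffel I b g p l i j (extChartAt I p p)
      - christoffel I b g p k j l (extChartAt I p p) * christoffel I b g p l i k (extChartAt I p p))

end Charts

section Volume

variable {d : ℕ} {H : Type*} [TopologicalSpace H]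
  (I : ModelWithCorners ℝ (EuclideanSpace ℝ (Fin d)) H)
  {N : Type*} [TopologicalSpace N] [ChartedSpace H N] [MeasurableSpace N]

/-- The standard basis of `ℝ^d`. -/
def stdBasis (d : ℕ) : Module.Basis (Fin d) ℝ (EuclideanSpace ℝ (Fin d)) :=
  (EuclideanSpace.basisFun (Fin d) ℝ).toBasis

/-- The measure `√(det g_{AB}) dx¹ ⋯ dx^d` on the domain of the preferred chart around `p`. -/
def chartVolume (g : ∀ x : N, TangentSpace I x →L[ℝ] TangentSpace I x →L[ℝ] ℝ)
    (p : N) : Measure N :=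
  ((volume.restrict (extChartAt I p).target).withDensity
    fun z => ENNReal.ofReal (Real.sqrt (coordMatrix I (stdBasis d) g p z).det)).map
      (extChartAt I p).symm

/-- The Riemannian measure `μ_g`: the smallest measure which dominates `√(det g_{AB}) dx` on every
chart. As the chart measures agree on overlaps, its restriction to the domain of each chart is
`√(det g_{AB}) dx`. -/
def riemannianMeasure (g : ∀ x : N, TangentSpace I x →L[ℝ] TangentSpace I x →L[ℝ] ℝ) :
    Measure N :=
  ⨆ p : N, chartVolume I g p

end Volume

section Radial

variable {d : ℕ} {H : Type*} [TopologicalSpace H]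
  (I : ModelWithCorners ℝ (EuclideanSpace ℝ (Fin d)) H)
  {N : Type*} [TopologicalSpace N] [ChartedSpace H N]

/-- The bilinear form `dr² + γ` on `ℝ × E`. -/
def radialForm {E : Type*} [NormedAddCommGroup E] [NormedSpace ℝ E] (γ : E →L[ℝ] E →L[ℝ] ℝ) :
    (ℝ × E) →L[ℝ] (ℝ × E) →L[ℝ] ℝ :=
  (ContinuousLinearMap.mul ℝ ℝ).bilinearComp
      (ContinuousLinearMap.fst ℝ ℝ E) (ContinuousLinearMap.fst ℝ ℝ E)
    + γ.bilinearComp (ContinuousLinearMap.snd ℝ ℝ E) (ContinuousLinearMap.snd ℝ ℝ E)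

/-- The metric `dr² + G(r)` on `ℝ × N`. -/
def radialMetric (G : ℝ → ∀ x : N, TangentSpace I x →L[ℝ] TangentSpace I x →L[ℝ] ℝ)
    (p : ℝ × N) : TangentSpace (𝓘(ℝ, ℝ).prod I) p →L[ℝ] TangentSpace (𝓘(ℝ, ℝ).prod I) p →L[ℝ] ℝ :=
  radialForm (E := EuclideanSpace ℝ (Fin d)) (G p.1 p.2)

/-- The warped product metric `dr² + h(r)² Ĝ` on `ℝ × N`. -/
def warpedMetric (h : ℝ → ℝ)
    (Ghat : ∀ x : N, TangentSpace I x →L[ℝ] TangentSpace I x →L[ℝ] ℝ) (p : ℝ × N) :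
    TangentSpace (𝓘(ℝ, ℝ).prod I) p →L[ℝ] TangentSpace (𝓘(ℝ, ℝ).prod I) p →L[ℝ] ℝ :=
  radialMetric I (fun r x => h r ^ 2 • Ghat x) p

theorem radialMetric_apply
    (G : ℝ → ∀ x : N, TangentSpace I x →L[ℝ] TangentSpace I x →L[ℝ] ℝ) (p : ℝ × N)
    (s t : ℝ) (v w : TangentSpace I p.2) :
    radialMetric I G p ((s, v) : ℝ × EuclideanSpace ℝ (Fin d))
      ((t, w) : ℝ × EuclideanSpace ℝ (Fin d)) = s * t + G p.1 p.2 v w :=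
  rfl

/-- The basis of `ℝ × ℝ^d` giving the coordinates `(r, x¹, …, x^d)`; the index of `r` is
`Sum.inl ()` and that of `x^A` is `Sum.inr A`. -/
def radialBasis (d : ℕ) : Module.Basis (Unit ⊕ Fin d) ℝ (ℝ × EuclideanSpace ℝ (Fin d)) :=
  (Module.Basis.singleton Unit ℝ).prod (stdBasis d)

/-- The Ricci curvature `R_{rr}` of the metric `g` on `ℝ × N` in the direction `(∂_r, ∂_r)`. -/
def ricciRR (g : ∀ p : ℝ × N, TangentSpace (𝓘(ℝ, ℝ).prod I) p →L[ℝ]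
    TangentSpace (𝓘(ℝ, ℝ).prod I) p →L[ℝ] ℝ) (p : ℝ × N) : ℝ :=
  ricci (𝓘(ℝ, ℝ).prod I) (radialBasis d) g p (Sum.inl ()) (Sum.inl ())

/-- The Weingarten map `X ↦ ∇_X ∂_r` at `p` of the level set of `r` through `p`, with respect to the
unit normal `∂_r` of a metric `g = dr² + G(r)`: its matrix is `S^B_A = Γ^B_{A r}`. -/
def weingarten (g : ∀ p : ℝ × N, TangentSpace (𝓘(ℝ, ℝ).prod I) p →L[ℝ]
    TangentSpace (𝓘(ℝ, ℝ).prod I) p →L[ℝ] ℝ) (p : ℝ × N) : Matrix (Fin d) (Fin d) ℝ :=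
  Matrix.of fun B A => christoffel (𝓘(ℝ, ℝ).prod I) (radialBasis d) g p
    (Sum.inr B) (Sum.inr A) (Sum.inl ()) (extChartAt (𝓘(ℝ, ℝ).prod I) p p)

/-- The mean curvature at `p` of the level set of `r` through `p`, for a metric
`g = dr² + G(r)`. -/
def meanCurvature (g : ∀ p : ℝ × N, TangentSpace (𝓘(ℝ, ℝ).prod I) p →L[ℝ]
    TangentSpace (𝓘(ℝ, ℝ).prod I) p →L[ℝ] ℝ) (p : ℝ × N) : ℝ :=
  (weingarten I g p).trace

/-- The radial mass `m(r, x) = h(r)² (H₀ - H)` of `g`, relative to `g₀ = dr² + h(r)² Ĝ`. -/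
def radialMass (g : ∀ p : ℝ × N, TangentSpace (𝓘(ℝ, ℝ).prod I) p →L[ℝ]
    TangentSpace (𝓘(ℝ, ℝ).prod I) p →L[ℝ] ℝ) (h : ℝ → ℝ)
    (Ghat : ∀ x : N, TangentSpace I x →L[ℝ] TangentSpace I x →L[ℝ] ℝ) (p : ℝ × N) : ℝ :=
  h p.1 ^ 2 * (meanCurvature I (warpedMetric I h Ghat) p - meanCurvature I g p)

/-- The radial mass `ℳ(r) = ∫_N m(r, x) dμ_Ĝ(x)` of `g`, relative to `g₀ = dr² + h(r)² Ĝ`, on the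
level set of `r`. -/
def totalMass [MeasurableSpace N]
    (g : ∀ p : ℝ × N, TangentSpace (𝓘(ℝ, ℝ).prod I) p →L[ℝ]
    TangentSpace (𝓘(ℝ, ℝ).prod I) p →L[ℝ] ℝ) (h : ℝ → ℝ)
    (Ghat : ∀ x : N, TangentSpace I x →L[ℝ] TangentSpace I x →L[ℝ] ℝ) (r : ℝ) : ℝ :=
  ∫ x, radialMass I g h Ghat (r, x) ∂(riemannianMeasure I Ghat)

/-- The function `h² (R_{rr} - R⁰_{rr})` on `ℝ × N`, where `R_{rr}` and `R⁰_{rr}` are the radial Ricci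
curvatures of `g` and of `g₀ = dr² + h(r)² Ĝ`. -/
def ricciDefect (g : ∀ p : ℝ × N, TangentSpace (𝓘(ℝ, ℝ).prod I) p →L[ℝ]
    TangentSpace (𝓘(ℝ, ℝ).prod I) p →L[ℝ] ℝ) (h : ℝ → ℝ)
    (Ghat : ∀ x : N, TangentSpace I x →L[ℝ] TangentSpace I x →L[ℝ] ℝ) (p : ℝ × N) : ℝ :=
  h p.1 ^ 2 * (ricciRR I g p - ricciRR I (warpedMetric I h Ghat) p)

/-- The open interval `(a, b)` of the real line, where `a` and `b` may be infinite. -/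
def realIoo (a b : EReal) : Set ℝ := {r : ℝ | a < (r : EReal) ∧ (r : EReal) < b}

/-- The filter of real numbers `r ∈ (a, b)` tending to `r₀ ∈ [a, b]`. -/
def nhdsIoo (a b r₀ : EReal) : Filter ℝ :=
  comap (fun r : ℝ => (r : EReal)) (𝓝[Ioo a b] r₀)

/-- The norm `(γ^{AC} γ^{BD} T_{AB} T_{CD})^{1/2}` of a bilinear form `T` with respect to an inner
product `γ` on `ℝ^d`. -/
def tensorNorm (γ T : EuclideanSpace ℝ (Fin d) →L[ℝ] EuclideanSpace ℝ (Fin d) →L[ℝ] ℝ) : ℝ :=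
  let γinv : Matrix (Fin d) (Fin d) ℝ :=
    (Matrix.of fun A B => γ (stdBasis d A) (stdBasis d B))⁻¹
  Real.sqrt (∑ A, ∑ B, ∑ C, ∑ D, γinv A C * γinv B D *
    T (stdBasis d A) (stdBasis d B) * T (stdBasis d C) (stdBasis d D))

/-- `dr² + G(r)` is asymptotic to `dr² + h(r)² Ĝ` at `r₀ ∈ [a, b]`: the norm of `G(r) - h(r)² Ĝ`
with respect to `h(r)² Ĝ` tends to zero, uniformly on `N`, as `r ∈ (a, b)` tends to `r₀`. -/
def AsymptoticAt (a b r₀ : EReal)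
    (G : ℝ → ∀ x : N, TangentSpace I x →L[ℝ] TangentSpace I x →L[ℝ] ℝ) (h : ℝ → ℝ)
    (Ghat : ∀ x : N, TangentSpace I x →L[ℝ] TangentSpace I x →L[ℝ] ℝ) : Prop :=
  ∀ ε : ℝ, 0 < ε → ∀ᶠ r in nhdsIoo a b r₀, ∀ x : N,
    tensorNorm (h r ^ 2 • Ghat x) (G r x - h r ^ 2 • Ghat x) < ε

/-- The tensor field `g` on `ℝ × N` is smooth on the set `s`. -/
def SmoothMetricOn [IsManifold I ∞ N]
    (g : ∀ p : ℝ × N, TangentSpace (𝓘(ℝ, ℝ).prod I) p →L[ℝ]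
    TangentSpace (𝓘(ℝ, ℝ).prod I) p →L[ℝ] ℝ) (s : Set (ℝ × N)) : Prop :=
  ContMDiffOn (𝓘(ℝ, ℝ).prod I)
    ((𝓘(ℝ, ℝ).prod I).prod 𝓘(ℝ, (ℝ × EuclideanSpace ℝ (Fin d)) →L[ℝ]
      (ℝ × EuclideanSpace ℝ (Fin d)) →L[ℝ] ℝ)) ∞
    (fun p => Bundle.TotalSpace.mk' ((ℝ × EuclideanSpace ℝ (Fin d)) →L[ℝ]
      (ℝ × EuclideanSpace ℝ (Fin d)) →L[ℝ] ℝ) p (g p)) s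

/-- Smooth Riemannian metrics on `N`. -/
abbrev Metric (N : Type*) [TopologicalSpace N] [ChartedSpace H N] [IsManifold I ∞ N] :=
  Bundle.ContMDiffRiemannianMetric I ∞ (EuclideanSpace ℝ (Fin d))
    (fun x : N => TangentSpace I x)

end Radial

end RadialMass

end

/-!
Let `S` be the Weingarten map of the level sets, so that `H = tr S`. In the metric `dr² + G(r)` it
satisfies the Riccati equation, whose trace is `∂_r H = -R_rr - tr S²`. In the background metric
`S` is `k = h'/h` times the identity, and the two trace equations combine into

  `∂_r m = h² (R_rr - R⁰_rr) + h² tr (S - k)²`.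

As `S` is self-adjoint, the last term is nonnegative, and the inequality follows by integration over
`N` and over `(a, b)`. Equality forces `S = k`, i.e. `∂_r G = 2 k G`, which says that `h⁻² G` is
constant in `r`; when `g` is asymptotic to `g₀` somewhere, this constant can only be `Ĝ`.
-/

noncomputable section

namespace RadialMass

/-! ### Positive definite matrices and bilinear forms -/

section LinearAlgebra

open Matrix

variable {ι : Type*} [Fintype ι] [DecidableEq ι]

theorem conj_mul_conj {R : Type*} [CommRing R] {P : Matrix ι ι R} (hP : IsUnit P)
    (X Y : Matrix ι ι R) : (P⁻¹ * X * P) * (P⁻¹ * Y * P) = P⁻¹ * (X * Y) * P := by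
  rw [isUnit_iff_isUnit_det] at hP
  simp only [Matrix.mul_assoc, mul_nonsing_inv_cancel_left _ _ hP]

theorem inv_congruence_mul_congruence {R : Type*} [CommRing R] {P : Matrix ι ι R} (hP : IsUnit P)
    (A K : Matrix ι ι R) : (Pᵀ * A * P)⁻¹ * (Pᵀ * K * P) = P⁻¹ * (A⁻¹ * K) * P := by
  have hPT : IsUnit Pᵀ.det := by rwa [det_transpose, ← isUnit_iff_isUnit_det]
  simp only [Matrix.mul_inv_rev, Matrix.mul_assoc, nonsing_inv_mul_cancel_left _ _ hPT]

open scoped MatrixOrder in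
theorem exists_isUnit_inv_eq_transpose_mul_self {A : Matrix ι ι ℝ} (hA : A.PosDef) :
    ∃ L : Matrix ι ι ℝ, IsUnit L ∧ A⁻¹ = Lᵀ * L :=
  CStarAlgebra.isStrictlyPositive_iff_eq_star_mul_self.1 hA.inv.isStrictlyPositive

theorem trace_inv_mul_mul_inv_mul_transpose {A L : Matrix ι ι ℝ} (hL : A⁻¹ = Lᵀ * L)
    (K : Matrix ι ι ℝ) :
    (A⁻¹ * K * A⁻¹ * Kᵀ).trace = ((L * K * Lᵀ) * (L * K * Lᵀ)ᵀ).trace := by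
  rw [hL, show Lᵀ * L * K * (Lᵀ * L) * Kᵀ = Lᵀ * (L * K * Lᵀ * L * Kᵀ) by
    simp only [Matrix.mul_assoc], trace_mul_comm]
  simp only [transpose_mul, transpose_transpose, Matrix.mul_assoc]

theorem trace_inv_mul_mul_inv_mul_transpose_nonneg {A : Matrix ι ι ℝ} (hA : A.PosDef)
    (K : Matrix ι ι ℝ) : 0 ≤ (A⁻¹ * K * A⁻¹ * Kᵀ).trace := by
  obtain ⟨L, -, hL⟩ := exists_isUnit_inv_eq_transpose_mul_self hA
  rw [trace_inv_mul_mul_inv_mul_transpose hL]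
  exact (posSemidef_self_mul_conjTranspose (L * K * Lᵀ)).trace_nonneg

theorem trace_inv_mul_mul_inv_mul_transpose_eq_zero_iff {A K : Matrix ι ι ℝ} (hA : A.PosDef) :
    (A⁻¹ * K * A⁻¹ * Kᵀ).trace = 0 ↔ K = 0 := by
  obtain ⟨L, hLu, hL⟩ := exists_isUnit_inv_eq_transpose_mul_self hA
  rw [trace_inv_mul_mul_inv_mul_transpose hL, ← conjTranspose_eq_transpose_of_trivial (L * K * Lᵀ),
    trace_mul_conjTranspose_self_eq_zero_iff,
    ((isUnit_transpose L).2 hLu).mul_left_eq_zero, hLu.mul_right_eq_zero]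

theorem trace_sub_smul_one_sq {R : Type*} [CommRing R] (S : Matrix ι ι R) (k : R) :
    ((S - k • 1) ^ 2).trace = (S ^ 2).trace - 2 * k * S.trace + Fintype.card ι * k ^ 2 := by
  have expand : (S - k • 1) ^ 2 = S ^ 2 - (2 * k) • S + k ^ 2 • 1 := by
    simp only [sq, sub_mul, mul_sub, Matrix.mul_smul, Matrix.smul_mul, mul_one, one_mul, smul_smul]
    module
  rw [expand, trace_add, trace_sub, trace_smul, trace_smul, trace_one, smul_eq_mul, smul_eq_mul]
  ring

end LinearAlgebra

section FormMatrix

open Matrix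

variable {ι : Type*} {E : Type*} [NormedAddCommGroup E] [NormedSpace ℝ E]

/-- The matrix `γ(bᵢ, bⱼ)` of a bilinear form in a basis. -/
def formMatrix (b : Module.Basis ι ℝ E) (γ : E →L[ℝ] E →L[ℝ] ℝ) : Matrix ι ι ℝ :=
  of fun i j => γ (b i) (b j)

theorem formMatrix_injective (b : Module.Basis ι ℝ E) : Function.Injective (formMatrix b) :=
  fun _ _ h => ContinuousLinearMap.coe_injective <| b.ext fun i =>
    ContinuousLinearMap.coe_injective <| b.ext fun j => congrFun₂ h i j

theorem toMatrix_toBilinForm [Fintype ι] [DecidableEq ι] (b : Module.Basis ι ℝ E)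
    (γ : E →L[ℝ] E →L[ℝ] ℝ) :
    LinearMap.BilinForm.toMatrix b γ.toBilinForm = formMatrix b γ := by
  ext i j
  simp [formMatrix, LinearMap.BilinForm.toMatrix_apply]

theorem formMatrix_change_basis [Fintype ι] (b c : Module.Basis ι ℝ E) (γ : E →L[ℝ] E →L[ℝ] ℝ) :
    formMatrix c γ = (b.toMatrix c)ᵀ * formMatrix b γ * b.toMatrix c := by
  classical
  rw [← toMatrix_toBilinForm, ← toMatrix_toBilinForm,
    LinearMap.BilinForm.toMatrix_mul_basis_toMatrix]

theorem formMatrix_bilinearComp [Fintype ι] [DecidableEq ι] (b : Module.Basis ι ℝ E)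
    (γ : E →L[ℝ] E →L[ℝ] ℝ) (L : E →L[ℝ] E) :
    formMatrix b (γ.bilinearComp L L) =
      (LinearMap.toMatrix b b L)ᵀ * formMatrix b γ * LinearMap.toMatrix b b L := by
  rw [← toMatrix_toBilinForm, ← toMatrix_toBilinForm, ← LinearMap.BilinForm.toMatrix_comp]
  rfl

theorem posDef_formMatrix [Finite ι] (b : Module.Basis ι ℝ E) {γ : E →L[ℝ] E →L[ℝ] ℝ}
    (hsymm : ∀ v w, γ v w = γ w v) (hpos : ∀ v, v ≠ 0 → 0 < γ v v) : (formMatrix b γ).PosDef := by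
  cases nonempty_fintype ι
  refine .of_dotProduct_mulVec_pos (by ext i j; exact hsymm _ _) fun c hc => ?_
  have hv : ∑ i, c i • b i ≠ 0 := fun h =>
    hc (funext (Fintype.linearIndependent_iff.1 b.linearIndependent c h))
  simpa [formMatrix, dotProduct, mulVec, Finset.mul_sum, mul_comm, mul_left_comm, hsymm]
    using hpos _ hv

theorem tensorNorm_eq_sqrt_trace {d : ℕ}
    {γ : EuclideanSpace ℝ (Fin d) →L[ℝ] EuclideanSpace ℝ (Fin d) →L[ℝ] ℝ}
    (hγ : ∀ v w, γ v w = γ w v)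
    (T : EuclideanSpace ℝ (Fin d) →L[ℝ] EuclideanSpace ℝ (Fin d) →L[ℝ] ℝ) :
    tensorNorm γ T = √((formMatrix (stdBasis d) γ)⁻¹ * formMatrix (stdBasis d) T *
      (formMatrix (stdBasis d) γ)⁻¹ * (formMatrix (stdBasis d) T)ᵀ).trace := by
  have hsymm : ((formMatrix (stdBasis d) γ)⁻¹).IsSymm :=
    IsSymm.inv (IsSymm.ext fun i j => hγ _ _)
  rw [tensorNorm, trace]
  congr 1
  refine Finset.sum_congr rfl fun A _ => ?_
  rw [diag_apply, mul_apply]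
  refine Finset.sum_congr rfl fun B _ => ?_
  simp only [mul_apply, Finset.sum_mul]
  rw [Finset.sum_comm]
  refine Finset.sum_congr rfl fun D _ => Finset.sum_congr rfl fun C _ => ?_
  rw [hsymm.apply B D, formMatrix, formMatrix, transpose_apply, of_apply, of_apply]
  ring

theorem tensorNorm_eq_zero_iff {d : ℕ}
    {γ T : EuclideanSpace ℝ (Fin d) →L[ℝ] EuclideanSpace ℝ (Fin d) →L[ℝ] ℝ}
    (hsymm : ∀ v w, γ v w = γ w v) (hpos : ∀ v, v ≠ 0 → 0 < γ v v) :
    tensorNorm γ T = 0 ↔ T = 0 := by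
  have hA := posDef_formMatrix (stdBasis d) hsymm hpos
  rw [tensorNorm_eq_sqrt_trace hsymm,
    Real.sqrt_eq_zero (trace_inv_mul_mul_inv_mul_transpose_nonneg hA _),
    trace_inv_mul_mul_inv_mul_transpose_eq_zero_iff hA]
  exact (formMatrix_injective (stdBasis d)).eq_iff' (Matrix.ext fun _ _ => rfl)

theorem tensorNorm_smul_smul {d : ℕ}
    {γ : EuclideanSpace ℝ (Fin d) →L[ℝ] EuclideanSpace ℝ (Fin d) →L[ℝ] ℝ}
    (hsymm : ∀ v w, γ v w = γ w v) (hpos : ∀ v, v ≠ 0 → 0 < γ v v) {c : ℝ} (hc : c ≠ 0)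
    (T : EuclideanSpace ℝ (Fin d) →L[ℝ] EuclideanSpace ℝ (Fin d) →L[ℝ] ℝ) :
    tensorNorm (c • γ) (c • T) = tensorNorm γ T := by
  have hdet := (posDef_formMatrix (stdBasis d) hsymm hpos).det_pos.ne'.isUnit
  have formMatrix_smul : ∀ S, formMatrix (stdBasis d) (c • S) = c • formMatrix (stdBasis d) S :=
    fun S => rfl
  rw [tensorNorm_eq_sqrt_trace fun v w => congrArg (c * ·) (hsymm v w),
    tensorNorm_eq_sqrt_trace hsymm, formMatrix_smul, formMatrix_smul,
    show (c • formMatrix (stdBasis d) γ)⁻¹ = c⁻¹ • (formMatrix (stdBasis d) γ)⁻¹ from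
      inv_smul' _ (Units.mk0 c hc) hdet]
  simp only [transpose_smul, Matrix.smul_mul, Matrix.mul_smul, smul_smul, mul_assoc,
    mul_inv_cancel₀ hc, one_smul]

end FormMatrix

section Smooth

theorem hasDerivAt_mul_mul {ι κ m n : Type*} [Fintype m] [Fintype n] {A : ℝ → Matrix m n ℝ}
    {A' : Matrix m n ℝ} {r : ℝ} (hA : ∀ i j, HasDerivAt (fun t => A t i j) (A' i j) r)
    (C : Matrix ι m ℝ) (D : Matrix n κ ℝ) (i : ι) (j : κ) :
    HasDerivAt (fun t => (C * A t * D) i j) ((C * A' * D) i j) r := by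
  simp only [Matrix.mul_apply]
  exact HasDerivAt.fun_sum fun k _ =>
    (HasDerivAt.fun_sum fun l _ => (hA l k).const_mul _).mul_const _

variable {E : Type*} [NormedAddCommGroup E] [NormedSpace ℝ E] {s : Set E} {k : WithTop ℕ∞}
  {ι : Type*} [Fintype ι] [DecidableEq ι] {A : E → Matrix ι ι ℝ}

theorem contDiffOn_matrix_det (hA : ∀ i j, ContDiffOn ℝ k (fun z => A z i j) s) :
    ContDiffOn ℝ k (fun z => (A z).det) s := by
  simp_rw [Matrix.det_apply]
  exact ContDiffOn.sum fun σ _ => (contDiffOn_prod fun i _ => hA _ _).const_smul _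

theorem contDiffOn_matrix_inv (hA : ∀ i j, ContDiffOn ℝ k (fun z => A z i j) s)
    (hdet : ∀ z ∈ s, (A z).det ≠ 0) (i j : ι) :
    ContDiffOn ℝ k (fun z => (A z)⁻¹ i j) s := by
  simp_rw [Matrix.inv_def, Ring.inverse_eq_inv', Matrix.smul_apply, Matrix.adjugate_apply]
  refine ((contDiffOn_matrix_det hA).inv hdet).mul (contDiffOn_matrix_det fun a b => ?_)
  by_cases h : a = j
  · subst h; simpa only [Matrix.updateRow_self] using contDiffOn_const
  · simpa only [Matrix.updateRow_ne h] using hA a b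

end Smooth

/-! ### Coordinates -/

section Coordinates

variable {V : Type*} [NormedAddCommGroup V] [NormedSpace ℝ V]
  {H : Type*} [TopologicalSpace H] {I : ModelWithCorners ℝ V H}
  {M : Type*} [TopologicalSpace M] [ChartedSpace H M]
  {ι : Type*} {b : Module.Basis ι ℝ V}

/-- Fields of bilinear forms on the tangent spaces of `M`. No regularity is required. -/
abbrev BilinField (I : ModelWithCorners ℝ V H) (M : Type*) [TopologicalSpace M]
    [ChartedSpace H M] : Type _ :=
  ∀ q : M, TangentSpace I q →L[ℝ] TangentSpace I q →L[ℝ] ℝ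

section CoordDeriv

variable {s : Set V} {z : V} {f f' : V → ℝ}

theorem coordDeriv_eq_fderivWithin (hs : s =ᶠ[𝓝 z] range I) (i : ι) (f : V → ℝ) :
    coordDeriv I b i f z = fderivWithin ℝ f s z (b i) := by
  rw [coordDeriv, fderivWithin_congr_set hs]

theorem coordDeriv_congr (hs : s =ᶠ[𝓝 z] range I) (hz : z ∈ s) (h : EqOn f f' s) (i : ι) :
    coordDeriv I b i f z = coordDeriv I b i f' z := by
  rw [coordDeriv_eq_fderivWithin hs, coordDeriv_eq_fderivWithin hs, fderivWithin_congr h (h hz)]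

theorem coordDeriv_eq_zero (hs : s =ᶠ[𝓝 z] range I) (hz : z ∈ s) {c : ℝ} (h : ∀ y ∈ s, f y = c)
    (i : ι) : coordDeriv I b i f z = 0 := by
  rw [coordDeriv_congr hs hz (f' := fun _ => c) h, coordDeriv, fderivWithin_fun_const]
  rfl

theorem uniqueDiffWithinAt_of_eventuallyEq_range (hs : s =ᶠ[𝓝 z] range I) (hz : z ∈ s) :
    UniqueDiffWithinAt ℝ s z :=
  (uniqueDiffWithinAt_congr (nhdsWithin_eq_iff_eventuallyEq.2 hs)).2
    (I.uniqueDiffOn z (hs.mem_iff.self_of_nhds.1 hz))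

theorem coordDeriv_sum {κ : Type*} (u : Finset κ) {f : κ → V → ℝ} (hs : s =ᶠ[𝓝 z] range I)
    (hz : z ∈ s) (hf : ∀ A ∈ u, DifferentiableWithinAt ℝ (f A) s z) (i : ι) :
    coordDeriv I b i (fun y => ∑ A ∈ u, f A y) z = ∑ A ∈ u, coordDeriv I b i (f A) z := by
  simp only [coordDeriv_eq_fderivWithin hs]
  rw [fderivWithin_fun_sum (uniqueDiffWithinAt_of_eventuallyEq_range hs hz) hf, sum_apply]

theorem contDiffOn_coordDeriv (hs : ∀ z ∈ s, s =ᶠ[𝓝 z] range I) {k m : WithTop ℕ∞}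
    (hf : ContDiffOn ℝ k f s) (hmk : m + 1 ≤ k) (i : ι) :
    ContDiffOn ℝ m (coordDeriv I b i f) s :=
  ((hf.fderivWithin (fun z hz => uniqueDiffWithinAt_of_eventuallyEq_range (hs z hz) hz)
    hmk).clm_apply contDiffOn_const).congr fun z hz => coordDeriv_eq_fderivWithin (hs z hz) i f

end CoordDeriv

theorem coordVec_eq_localFrame [IsManifold I 1 M] {p : M} {z : V}
    (hz : z ∈ (extChartAt I p).target) (i : ι) :
    coordVec I b p z i =
      (trivializationAt V (TangentSpace I) p).localFrame b i ((extChartAt I p).symm z) := by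
  have hs : (extChartAt I p).symm z ∈ (chartAt H p).source := by
    rw [← extChartAt_source (I := I)]
    exact (extChartAt I p).map_target hz
  have hb : (extChartAt I p).symm z ∈ (trivializationAt V (TangentSpace I) p).baseSet := hs
  have hsymm := DFunLike.congr_fun (TangentBundle.symmL_trivializationAt (𝕜 := ℝ) (I := I) hs) (b i)
  rw [(extChartAt I p).right_inv hz, Bundle.Trivialization.symmL_apply _ hb] at hsymm
  rw [Bundle.Trivialization.localFrame_apply_of_mem_baseSet _ _ hb, Bundle.Trivialization.basisAt,
    Module.Basis.map_apply]
  exact hsymm.symm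

theorem exists_basis_coordMatrix_eq [IsManifold I 1 M] {p x : M}
    (hx : x ∈ (extChartAt I p).source) :
    ∃ c : Module.Basis ι ℝ V, ∀ γ : BilinField I M,
      coordMatrix I b γ p (extChartAt I p x) = formMatrix c (γ x) := by
  obtain ⟨L, hL⟩ := isInvertible_mfderivWithin_extChartAt_symm (I := I)
    ((extChartAt I p).map_source hx)
  have hcoord : ∀ i, (coordVec I b p (extChartAt I p x) i : V) = b.map L.toLinearEquiv i :=
    fun i => by rw [coordVec, ← hL]; rfl
  refine ⟨b.map L.toLinearEquiv, fun γ => ?_⟩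
  have hbase : ∀ y, y = x → ∀ v w : V, (γ y : V →L[ℝ] V →L[ℝ] ℝ) v w = γ x v w := by
    rintro y rfl v w
    rfl
  ext i j
  refine (hbase _ ((extChartAt I p).left_inv hx) _ _).trans ?_
  rw [hcoord, hcoord]
  rfl

theorem exists_isUnit_coordMatrix_eq [Fintype ι] [DecidableEq ι] [IsManifold I 1 M] {p q x : M}
    (hp : x ∈ (extChartAt I p).source) (hq : x ∈ (extChartAt I q).source) :
    ∃ P : Matrix ι ι ℝ, IsUnit P ∧ ∀ γ : BilinField I M,
      coordMatrix I b γ p (extChartAt I p x) =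
        P.transpose * coordMatrix I b γ q (extChartAt I q x) * P := by
  obtain ⟨c, hc⟩ := exists_basis_coordMatrix_eq (b := b) hp
  obtain ⟨e, he⟩ := exists_basis_coordMatrix_eq (b := b) hq
  have := e.invertibleToMatrix c
  refine ⟨e.toMatrix c, isUnit_of_invertible _, fun γ => ?_⟩
  rw [hc, he]
  exact formMatrix_change_basis e c (γ x)

theorem contDiffOn_coordMatrix [IsManifold I ∞ M] {g : BilinField I M} {s : Set M}
    (hg : ContMDiffOn I (I.prod 𝓘(ℝ, V →L[ℝ] V →L[ℝ] ℝ)) ∞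
      (fun q => Bundle.TotalSpace.mk' (V →L[ℝ] V →L[ℝ] ℝ) q (g q)) s) (p : M) (i j : ι) :
    ContDiffOn ℝ ∞ (fun z => coordMatrix I b g p z i j)
      ((extChartAt I p).target ∩ (extChartAt I p).symm ⁻¹' s) := by
  set e := trivializationAt V (TangentSpace I : M → Type _) p
  have frame_smooth : ∀ k, ContMDiffOn I (I.prod 𝓘(ℝ, V)) ∞
      (fun q => Bundle.TotalSpace.mk' V q (e.localFrame b k q)) ((extChartAt I p).source ∩ s) := by
    rw [extChartAt_source]
    exact fun k => (e.contMDiffOn_localFrame_baseSet ∞ b k).mono inter_subset_left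
  have component_smooth : ContMDiffOn I 𝓘(ℝ, ℝ) ∞
      (fun q => g q (e.localFrame b i q) (e.localFrame b j q)) ((extChartAt I p).source ∩ s) :=
    fun q hq => (Bundle.contMDiffWithinAt_totalSpace.1 (((hg.mono inter_subset_right
      ).clm_bundle_apply₂ (frame_smooth i) (frame_smooth j)) q hq)).2
  have component_chart_smooth := component_smooth.comp
    ((contMDiffOn_extChartAt_symm p).mono inter_subset_left)
    fun z hz => ⟨(extChartAt I p).map_target hz.1, hz.2⟩
  refine (contMDiffOn_iff_contDiffOn.1 component_chart_smooth).congr fun z hz => ?_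
  simp only [coordMatrix, Matrix.of_apply, coordVec_eq_localFrame hz.1]
  rfl

end Coordinates

section RadialCoordinates

variable {V : Type*} [NormedAddCommGroup V] [NormedSpace ℝ V]
  {H : Type*} [TopologicalSpace H] {I : ModelWithCorners ℝ V H}
  {N : Type*} [TopologicalSpace N] [ChartedSpace H N]

theorem prod_target_eventuallyEq_range {J : Set ℝ} (hJ : IsOpen J) {x₀ : N} {z : ℝ × V}
    (hz : z ∈ J ×ˢ (extChartAt I x₀).target) :
    (J ×ˢ (extChartAt I x₀).target : Set (ℝ × V)) =ᶠ[𝓝 z] range (𝓘(ℝ, ℝ).prod I) := by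
  rw [ModelWithCorners.range_prod, ModelWithCorners.range_eq_univ,
    ← nhdsWithin_eq_iff_eventuallyEq, nhdsWithin_prod_eq, nhdsWithin_prod_eq,
    nhdsWithin_univ, hJ.nhdsWithin_eq hz.1,
    nhdsWithin_eq_iff_eventuallyEq.2 (extChartAt_target_eventuallyEq_of_mem hz.2)]

theorem mfderivWithin_extChartAt_prod_symm [IsManifold I 1 N] {p : ℝ × N} {z : ℝ × V}
    (hz : z.2 ∈ (extChartAt I p.2).target) (v : ℝ × V) :
    (mfderivWithin 𝓘(ℝ, ℝ × V) (𝓘(ℝ, ℝ).prod I) (extChartAt (𝓘(ℝ, ℝ).prod I) p).symm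
      (range (𝓘(ℝ, ℝ).prod I)) z v : ℝ × V) =
      (v.1, mfderivWithin 𝓘(ℝ, V) I (extChartAt I p.2).symm (range I) z.2 v.2) := by
  have range_eq : range (𝓘(ℝ, ℝ).prod I) = univ ×ˢ range I := by
    rw [ModelWithCorners.range_prod, ModelWithCorners.range_eq_univ]
  have deriv_fst : HasMFDerivWithinAt 𝓘(ℝ, ℝ × V) 𝓘(ℝ, ℝ) Prod.fst
      (range (𝓘(ℝ, ℝ).prod I)) z (ContinuousLinearMap.fst ℝ ℝ V) :=
    hasFDerivAt_fst.hasFDerivWithinAt.hasMFDerivWithinAt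
  have deriv_snd : HasMFDerivWithinAt 𝓘(ℝ, ℝ × V) 𝓘(ℝ, V) Prod.snd
      (range (𝓘(ℝ, ℝ).prod I)) z (ContinuousLinearMap.snd ℝ ℝ V) :=
    hasFDerivAt_snd.hasFDerivWithinAt.hasMFDerivWithinAt
  have deriv_symm := HasMFDerivWithinAt.comp z
    (mdifferentiableWithinAt_extChartAt_symm hz).hasMFDerivWithinAt deriv_snd
    fun y hy => (range_eq ▸ hy).2
  have unique : UniqueMDiffWithinAt 𝓘(ℝ, ℝ × V) (range (𝓘(ℝ, ℝ).prod I)) z :=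
    (𝓘(ℝ, ℝ).prod I).uniqueDiffOn.uniqueMDiffOn z
      (range_eq ▸ ⟨mem_univ _, extChartAt_target_subset_range _ hz⟩)
  exact DFunLike.congr_fun ((deriv_fst.prodMk deriv_symm).mfderivWithin unique) v

end RadialCoordinates

/-! ### Curvature of radial metrics -/

section RadialCurvature

local notation "∂[" I "]" => coordDeriv (ModelWithCorners.prod 𝓘(ℝ, ℝ) I) (radialBasis _)
local notation "Γ[" I "," G "]" => christoffel _ (radialBasis _) (radialMetric I G)

section RadialFrames

variable {d : ℕ} {H : Type*} [TopologicalSpace H]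
  {I : ModelWithCorners ℝ (EuclideanSpace ℝ (Fin d)) H}
  {N : Type*} [TopologicalSpace N] [ChartedSpace H N] [IsManifold I 1 N]
  {p : ℝ × N} {z : ℝ × EuclideanSpace ℝ (Fin d)}

theorem coordVec_radial_inl (hz : z.2 ∈ (extChartAt I p.2).target) :
    (coordVec (𝓘(ℝ, ℝ).prod I) (radialBasis d) p z (Sum.inl ()) :
      ℝ × EuclideanSpace ℝ (Fin d)) = (1, 0) := by
  refine (mfderivWithin_extChartAt_prod_symm hz _).trans ?_
  rw [show radialBasis d (Sum.inl ()) = (1, 0) by simp [radialBasis]]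
  exact congrArg (Prod.mk (1 : ℝ)) (map_zero _)

theorem coordVec_radial_inr (hz : z.2 ∈ (extChartAt I p.2).target) (A : Fin d) :
    (coordVec (𝓘(ℝ, ℝ).prod I) (radialBasis d) p z (Sum.inr A) :
      ℝ × EuclideanSpace ℝ (Fin d)) = (0, coordVec I (stdBasis d) p.2 z.2 A) := by
  refine (mfderivWithin_extChartAt_prod_symm hz _).trans ?_
  rw [show radialBasis d (Sum.inr A) = (0, stdBasis d A) by simp [radialBasis]]
  rfl

theorem coordMatrix_radial {G : ℝ → BilinField I N} (hz : z.2 ∈ (extChartAt I p.2).target) :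
    coordMatrix (𝓘(ℝ, ℝ).prod I) (radialBasis d) (radialMetric I G) p z =
      Matrix.fromBlocks 1 0 0 (coordMatrix I (stdBasis d) (G z.1) p.2 z.2) := by
  obtain ⟨γ, hγ⟩ : ∃ γ : EuclideanSpace ℝ (Fin d) →L[ℝ] EuclideanSpace ℝ (Fin d) →L[ℝ] ℝ,
      γ = G z.1 ((extChartAt I p.2).symm z.2) := ⟨_, rfl⟩
  have radial_apply : ∀ v w : ℝ × EuclideanSpace ℝ (Fin d),
      radialMetric I G ((extChartAt (𝓘(ℝ, ℝ).prod I) p).symm z) v w =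
        v.1 * w.1 + γ v.2 w.2 := by
    subst hγ
    exact fun _ _ => rfl
  ext (i | A) (j | B) <;> refine (radial_apply _ _).trans ?_
  · simp [coordVec_radial_inl hz, Matrix.one_apply_eq]
  · rw [coordVec_radial_inl hz, coordVec_radial_inr hz]
    simp only [mul_zero, map_zero, zero_add, Matrix.fromBlocks_apply₁₂, Matrix.zero_apply]
    rfl
  · rw [coordVec_radial_inl hz, coordVec_radial_inr hz]
    simp
  · rw [coordVec_radial_inr hz, coordVec_radial_inr hz, hγ]
    simp only [mul_zero, zero_add, Matrix.fromBlocks_apply₂₂, coordMatrix, Matrix.of_apply]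
    rfl

end RadialFrames

theorem hasDerivAt_radial {d : ℕ} {H : Type*} [TopologicalSpace H]
    {I : ModelWithCorners ℝ (EuclideanSpace ℝ (Fin d)) H} {N : Type*} [TopologicalSpace N]
    [ChartedSpace H N] {J : Set ℝ} (hJ : IsOpen J) {x₀ : N}
    {z : ℝ × EuclideanSpace ℝ (Fin d)} (hz : z ∈ J ×ˢ (extChartAt I x₀).target)
    {f : ℝ × EuclideanSpace ℝ (Fin d) → ℝ}
    (hf : DifferentiableWithinAt ℝ f (J ×ˢ (extChartAt I x₀).target) z) :
    HasDerivAt (fun t => f (t, z.2)) (∂[I] (Sum.inl ()) f z) z.1 := by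
  rw [coordDeriv_eq_fderivWithin (prod_target_eventuallyEq_range hJ hz)]
  have line : HasDerivWithinAt (fun t : ℝ => (t, z.2)) (radialBasis d (Sum.inl ())) J z.1 := by
    rw [show radialBasis d (Sum.inl ()) = (1, 0) by simp [radialBasis]]
    exact (hasDerivWithinAt_id _ _).prodMk (hasDerivWithinAt_const _ _ _)
  have mapsTo : MapsTo (fun t : ℝ => (t, z.2)) J (J ×ˢ (extChartAt I x₀).target) :=
    fun t ht => ⟨ht, hz.2⟩
  exact (hf.hasFDerivWithinAt.comp_hasDerivWithinAt z.1 line mapsTo).hasDerivAt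
    (hJ.mem_nhds hz.1)

theorem fromBlocks_one_inv {ι κ R : Type*} [Fintype ι] [DecidableEq ι] [Fintype κ]
    [DecidableEq κ] [CommRing R] {A : Matrix κ κ R} (hA : IsUnit A.det) :
    (Matrix.fromBlocks (1 : Matrix ι ι R) 0 0 A)⁻¹ = Matrix.fromBlocks 1 0 0 A⁻¹ := by
  refine Matrix.inv_eq_right_inv ?_
  rw [Matrix.fromBlocks_multiply]
  simp [Matrix.mul_nonsing_inv _ hA]

section ChartWeingarten

variable {d : ℕ} {H : Type*} [TopologicalSpace H]
  (I : ModelWithCorners ℝ (EuclideanSpace ℝ (Fin d)) H)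
  {N : Type*} [TopologicalSpace N] [ChartedSpace H N]

/-- A family `G(r)`, `r ∈ J`, of bilinear forms on the tangent spaces of `N` is of class `C^k` if
its components in every chart are `C^k` functions of `r` and of the coordinates. -/
def IsContDiffFamily (k : WithTop ℕ∞) (J : Set ℝ) (G : ℝ → BilinField I N) : Prop :=
  ∀ (x₀ : N) (i j : Fin d), ContDiffOn ℝ k
    (fun z : ℝ × EuclideanSpace ℝ (Fin d) => coordMatrix I (stdBasis d) (G z.1) x₀ z.2 i j)
    (J ×ˢ (extChartAt I x₀).target)

/-- A `C^k` family `G(r)`, `r ∈ J`, of Riemannian metrics on `N`. -/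
structure IsMetricFamily (k : WithTop ℕ∞) (J : Set ℝ) (G : ℝ → BilinField I N) : Prop where
  contDiff : IsContDiffFamily I k J G
  symm : ∀ r ∈ J, ∀ x v w, G r x v w = G r x w v
  pos : ∀ r ∈ J, ∀ x v, v ≠ 0 → 0 < G r x v v

/-- The matrix `(∂ᵣ G)_{AC}` of the radial derivative of the family `G(r)` in the chart around
`x₀`. -/
def familyDeriv (G : ℝ → BilinField I N) (x₀ : N) (z : ℝ × EuclideanSpace ℝ (Fin d)) :
    Matrix (Fin d) (Fin d) ℝ :=
  Matrix.of fun A C => ∂[I] (Sum.inl ())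
    (fun y => coordMatrix I (stdBasis d) (G y.1) x₀ y.2 A C) z

/-- The matrix `S^B_A = ½ G^{BC} (∂ᵣ G)_{AC}` of the Weingarten map of the level sets of `r` in the
chart around `x₀`. Unlike `weingarten`, it is evaluated on the whole domain of that chart. -/
def chartWeingarten (G : ℝ → BilinField I N) (x₀ : N) (z : ℝ × EuclideanSpace ℝ (Fin d)) :
    Matrix (Fin d) (Fin d) ℝ :=
  (1 / 2 : ℝ) • ((coordMatrix I (stdBasis d) (G z.1) x₀ z.2)⁻¹ *
    (familyDeriv I G x₀ z).transpose)

end ChartWeingarten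

variable {d : ℕ} {H : Type*} [TopologicalSpace H]
  {I : ModelWithCorners ℝ (EuclideanSpace ℝ (Fin d)) H}
  {N : Type*} [TopologicalSpace N] [ChartedSpace H N]
  {J : Set ℝ} {x₀ : N} {z : ℝ × EuclideanSpace ℝ (Fin d)} {G : ℝ → BilinField I N}

theorem IsMetricFamily.of_le {k m : WithTop ℕ∞} (hG : IsMetricFamily I k J G) (hmk : m ≤ k) :
    IsMetricFamily I m J G :=
  ⟨fun x₀ i j => (hG.contDiff x₀ i j).of_le hmk, hG.symm, hG.pos⟩

theorem hasDerivAt_coordMatrix (hJ : IsOpen J) (hG : IsContDiffFamily I 1 J G)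
    (hz : z ∈ J ×ˢ (extChartAt I x₀).target) (A C : Fin d) :
    HasDerivAt (fun t => coordMatrix I (stdBasis d) (G t) x₀ z.2 A C) (familyDeriv I G x₀ z A C)
      z.1 :=
  hasDerivAt_radial hJ hz ((hG x₀ A C).differentiableOn one_ne_zero z hz)

theorem exists_chartWeingarten_eq_conj [IsManifold I 1 N] {r : ℝ} {x x₁ : N} (hJ : IsOpen J)
    (hG : IsContDiffFamily I 1 J G) (hr : r ∈ J) (hx₀ : x ∈ (extChartAt I x₀).source)
    (hx₁ : x ∈ (extChartAt I x₁).source) :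
    ∃ P : Matrix (Fin d) (Fin d) ℝ, IsUnit P ∧
      chartWeingarten I G x₀ (r, extChartAt I x₀ x) =
        P⁻¹ * chartWeingarten I G x₁ (r, extChartAt I x₁ x) * P := by
  obtain ⟨P, hP, hcoord⟩ := exists_isUnit_coordMatrix_eq (b := stdBasis d) hx₀ hx₁
  have family_deriv : familyDeriv I G x₀ (r, extChartAt I x₀ x) =
      P.transpose * familyDeriv I G x₁ (r, extChartAt I x₁ x) * P := by
    ext i j
    have deriv₀ := hasDerivAt_coordMatrix hJ hG (z := (r, extChartAt I x₀ x))
      ⟨hr, (extChartAt I x₀).map_source hx₀⟩ i j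
    have deriv₁ := hasDerivAt_mul_mul (hasDerivAt_coordMatrix hJ hG
      (z := (r, extChartAt I x₁ x)) ⟨hr, (extChartAt I x₁).map_source hx₁⟩) P.transpose P i j
    simp only [hcoord] at deriv₀
    exact deriv₀.unique deriv₁
  have family_deriv_transpose : (familyDeriv I G x₀ (r, extChartAt I x₀ x)).transpose =
      P.transpose * (familyDeriv I G x₁ (r, extChartAt I x₁ x)).transpose * P := by
    simp only [family_deriv, Matrix.transpose_mul, Matrix.transpose_transpose, Matrix.mul_assoc]
  refine ⟨P, hP, ?_⟩
  rw [chartWeingarten, chartWeingarten, hcoord, family_deriv_transpose,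
    inv_congruence_mul_congruence hP, Matrix.mul_smul, Matrix.smul_mul]

section Christoffel

variable [IsManifold I 1 N] {p : ℝ × N}

theorem coordDeriv_coordMatrix_inl_left (hJ : IsOpen J)
    (hz : z ∈ J ×ˢ (extChartAt I p.2).target) (k i : Unit ⊕ Fin d) :
    ∂[I] k (fun y => coordMatrix (𝓘(ℝ, ℝ).prod I) (radialBasis d) (radialMetric I G) p y
      (Sum.inl ()) i) z = 0 := by
  refine coordDeriv_eq_zero (prod_target_eventuallyEq_range hJ hz) hz
    (c := (1 : Matrix (Unit ⊕ Fin d) (Unit ⊕ Fin d) ℝ) (Sum.inl ()) i) (fun y hy => ?_) k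
  rw [coordMatrix_radial hy.2]
  cases i <;> simp

theorem coordDeriv_coordMatrix_inl_right (hJ : IsOpen J)
    (hz : z ∈ J ×ˢ (extChartAt I p.2).target) (k i : Unit ⊕ Fin d) :
    ∂[I] k (fun y => coordMatrix (𝓘(ℝ, ℝ).prod I) (radialBasis d) (radialMetric I G) p y
      i (Sum.inl ())) z = 0 := by
  refine coordDeriv_eq_zero (prod_target_eventuallyEq_range hJ hz) hz
    (c := (1 : Matrix (Unit ⊕ Fin d) (Unit ⊕ Fin d) ℝ) i (Sum.inl ())) (fun y hy => ?_) k
  rw [coordMatrix_radial hy.2]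
  cases i <;> simp

theorem coordDeriv_coordMatrix_inr (hJ : IsOpen J)
    (hz : z ∈ J ×ˢ (extChartAt I p.2).target) (k : Unit ⊕ Fin d) (A C : Fin d) :
    ∂[I] k (fun y => coordMatrix (𝓘(ℝ, ℝ).prod I) (radialBasis d) (radialMetric I G) p y
      (Sum.inr A) (Sum.inr C)) z =
    ∂[I] k (fun y => coordMatrix I (stdBasis d) (G y.1) p.2 y.2 A C) z := by
  refine coordDeriv_congr (prod_target_eventuallyEq_range hJ hz) hz (fun y hy => ?_) k
  rw [coordMatrix_radial hy.2, Matrix.fromBlocks_apply₂₂]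

theorem christoffel_inl_inl (hJ : IsOpen J) (hz : z ∈ J ×ˢ (extChartAt I p.2).target)
    (k : Unit ⊕ Fin d) : Γ[I,G] p k (Sum.inl ()) (Sum.inl ()) z = 0 := by
  simp [christoffel, coordDeriv_coordMatrix_inl_left hJ hz]

theorem christoffel_inl_left (hJ : IsOpen J) (hz : z ∈ J ×ˢ (extChartAt I p.2).target)
    (hdet : IsUnit (coordMatrix I (stdBasis d) (G z.1) p.2 z.2).det) (i : Unit ⊕ Fin d) :
    Γ[I,G] p (Sum.inl ()) (Sum.inl ()) i z = 0 := by
  rw [christoffel, coordMatrix_radial hz.2, fromBlocks_one_inv hdet]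
  simp [coordDeriv_coordMatrix_inl_left hJ hz, coordDeriv_coordMatrix_inl_right hJ hz]

theorem christoffel_inr_inl_inr (hJ : IsOpen J) (hz : z ∈ J ×ˢ (extChartAt I p.2).target)
    (hdet : IsUnit (coordMatrix I (stdBasis d) (G z.1) p.2 z.2).det) (A B : Fin d) :
    Γ[I,G] p (Sum.inr B) (Sum.inl ()) (Sum.inr A) z = chartWeingarten I G p.2 z B A := by
  rw [christoffel, coordMatrix_radial hz.2, fromBlocks_one_inv hdet]
  simp [coordDeriv_coordMatrix_inl_left hJ hz, coordDeriv_coordMatrix_inr hJ hz, chartWeingarten,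
    familyDeriv, Matrix.mul_apply]

theorem christoffel_inr_inr_inl (hJ : IsOpen J) (hz : z ∈ J ×ˢ (extChartAt I p.2).target)
    (hdet : IsUnit (coordMatrix I (stdBasis d) (G z.1) p.2 z.2).det) (A B : Fin d) :
    Γ[I,G] p (Sum.inr B) (Sum.inr A) (Sum.inl ()) z = chartWeingarten I G p.2 z B A := by
  rw [christoffel, coordMatrix_radial hz.2, fromBlocks_one_inv hdet]
  simp [coordDeriv_coordMatrix_inl_left hJ hz, coordDeriv_coordMatrix_inl_right hJ hz,
    coordDeriv_coordMatrix_inr hJ hz, chartWeingarten, familyDeriv, Matrix.mul_apply]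

end Christoffel

namespace IsMetricFamily

variable [IsManifold I 1 N] {k : WithTop ℕ∞} {r : ℝ} {x : N}

theorem posDef_coordMatrix (hG : IsMetricFamily I k J G)
    (hz : z ∈ J ×ˢ (extChartAt I x₀).target) :
    (coordMatrix I (stdBasis d) (G z.1) x₀ z.2).PosDef := by
  obtain ⟨c, hc⟩ := exists_basis_coordMatrix_eq (b := stdBasis d)
    ((extChartAt I x₀).map_target hz.2)
  rw [(extChartAt I x₀).right_inv hz.2] at hc
  rw [hc]
  exact posDef_formMatrix c (hG.symm z.1 hz.1 _) (hG.pos z.1 hz.1 _)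

theorem isUnit_det_coordMatrix (hG : IsMetricFamily I k J G)
    (hz : z ∈ J ×ˢ (extChartAt I x₀).target) :
    IsUnit (coordMatrix I (stdBasis d) (G z.1) x₀ z.2).det :=
  (hG.posDef_coordMatrix hz).det_pos.ne'.isUnit

theorem contDiffOn_chartWeingarten {m : WithTop ℕ∞} (hJ : IsOpen J)
    (hG : IsMetricFamily I k J G) (hmk : m + 1 ≤ k) (x₀ : N) (i j : Fin d) :
    ContDiffOn ℝ m (fun z => chartWeingarten I G x₀ z i j) (J ×ˢ (extChartAt I x₀).target) := by
  have hmk' : m ≤ k := le_self_add.trans hmk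
  simp only [chartWeingarten, familyDeriv, Matrix.smul_apply, Matrix.mul_apply,
    Matrix.transpose_apply, Matrix.of_apply, smul_eq_mul]
  exact contDiffOn_const.mul <| ContDiffOn.sum fun l _ =>
    (contDiffOn_matrix_inv (fun A C => (hG.contDiff x₀ A C).of_le hmk')
      (fun z hz => (hG.isUnit_det_coordMatrix hz).ne_zero) i l).mul
    (contDiffOn_coordDeriv (fun z hz => prod_target_eventuallyEq_range hJ hz)
      (hG.contDiff x₀ j l) hmk _)

theorem weingarten_eq_chartWeingarten (hJ : IsOpen J) (hG : IsMetricFamily I k J G)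
    (hr : r ∈ J) (x : N) :
    weingarten I (radialMetric I G) (r, x) = chartWeingarten I G x (r, extChartAt I x x) := by
  have hz : (r, extChartAt I x x) ∈ J ×ˢ (extChartAt I x).target := ⟨hr, mem_extChartAt_target x⟩
  ext B A
  exact christoffel_inr_inr_inl (p := (r, x)) hJ hz (hG.isUnit_det_coordMatrix hz) A B

theorem ricciRR_eq_chartWeingarten (hJ : IsOpen J) (hG : IsMetricFamily I 2 J G) (hr : r ∈ J)
    (x : N) :
    ricciRR I (radialMetric I G) (r, x) =
      -∂[I] (Sum.inl ()) (fun z => (chartWeingarten I G x z).trace) (r, extChartAt I x x) -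
        (chartWeingarten I G x (r, extChartAt I x x) ^ 2).trace := by
  have hz : (r, extChartAt I x x) ∈ J ×ˢ (extChartAt I x).target := ⟨hr, mem_extChartAt_target x⟩
  have hs := prod_target_eventuallyEq_range hJ hz
  have deriv_christoffel_rr : ∀ k l : Unit ⊕ Fin d,
      ∂[I] l (Γ[I,G] (r, x) k (Sum.inl ()) (Sum.inl ())) (r, extChartAt I x x) = 0 := fun k l =>
    coordDeriv_eq_zero hs hz (fun y hy => christoffel_inl_inl (p := (r, x)) hJ hy k) l
  have deriv_christoffel_angular : ∀ A : Fin d,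
      ∂[I] (Sum.inl ()) (Γ[I,G] (r, x) (Sum.inr A) (Sum.inl ()) (Sum.inr A))
        (r, extChartAt I x x) =
      ∂[I] (Sum.inl ()) (fun z => chartWeingarten I G x z A A) (r, extChartAt I x x) := fun A =>
    coordDeriv_congr hs hz (fun y hy =>
      christoffel_inr_inl_inr (p := (r, x)) hJ hy (hG.isUnit_det_coordMatrix hy) A A) _
  have deriv_trace : ∂[I] (Sum.inl ()) (fun z => (chartWeingarten I G x z).trace)
        (r, extChartAt I x x) =
      ∑ A, ∂[I] (Sum.inl ()) (fun z => chartWeingarten I G x z A A) (r, extChartAt I x x) :=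
    coordDeriv_sum _ hs hz (fun A _ => (hG.contDiffOn_chartWeingarten (m := 1) hJ
      (by norm_num) x A A).differentiableOn one_ne_zero _ hz) _
  have center : extChartAt (𝓘(ℝ, ℝ).prod I) (r, x) (r, x) = (r, extChartAt I x x) := rfl
  have hdet := hG.isUnit_det_coordMatrix hz
  rw [ricciRR, ricci, center, deriv_trace]
  simp only [Fintype.sum_sum_type, Finset.univ_unique, Finset.sum_singleton, PUnit.default_eq_unit,
    deriv_christoffel_rr, deriv_christoffel_angular, christoffel_inl_inl (p := (r, x)) hJ hz,
    christoffel_inl_left (p := (r, x)) hJ hz hdet,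
    christoffel_inr_inl_inr (p := (r, x)) hJ hz hdet]
  simp [Matrix.trace, Matrix.mul_apply, sq, Finset.sum_neg_distrib, sub_eq_add_neg]

theorem trace_chartWeingarten (hJ : IsOpen J) (hG : IsMetricFamily I 1 J G) (hr : r ∈ J)
    (hx : x ∈ (extChartAt I x₀).source) :
    (chartWeingarten I G x₀ (r, extChartAt I x₀ x)).trace =
      meanCurvature I (radialMetric I G) (r, x) := by
  obtain ⟨P, hP, hconj⟩ :=
    exists_chartWeingarten_eq_conj hJ hG.contDiff hr hx (mem_extChartAt_source x)
  rw [hconj, Matrix.trace_conj' hP, meanCurvature, hG.weingarten_eq_chartWeingarten hJ hr]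

theorem trace_chartWeingarten_sq (hJ : IsOpen J) (hG : IsMetricFamily I 1 J G) (hr : r ∈ J)
    (hx : x ∈ (extChartAt I x₀).source) :
    (chartWeingarten I G x₀ (r, extChartAt I x₀ x) ^ 2).trace =
      (weingarten I (radialMetric I G) (r, x) ^ 2).trace := by
  obtain ⟨P, hP, hconj⟩ :=
    exists_chartWeingarten_eq_conj hJ hG.contDiff hr hx (mem_extChartAt_source x)
  rw [hconj, sq, conj_mul_conj hP, Matrix.trace_conj' hP, hG.weingarten_eq_chartWeingarten hJ hr,
    sq]

theorem contDiffOn_trace_chartWeingarten {m : WithTop ℕ∞} (hJ : IsOpen J)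
    (hG : IsMetricFamily I k J G) (hmk : m + 1 ≤ k) (x₀ : N) :
    ContDiffOn ℝ m (fun z => (chartWeingarten I G x₀ z).trace) (J ×ˢ (extChartAt I x₀).target) :=
  ContDiffOn.sum fun A _ => hG.contDiffOn_chartWeingarten hJ hmk x₀ A A

theorem hasDerivAt_meanCurvature_chart (hJ : IsOpen J) (hG : IsMetricFamily I 2 J G)
    (hr : r ∈ J) (hx : x ∈ (extChartAt I x₀).source) :
    HasDerivAt (fun t => meanCurvature I (radialMetric I G) (t, x))
      (∂[I] (Sum.inl ()) (fun z => (chartWeingarten I G x₀ z).trace) (r, extChartAt I x₀ x)) r := by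
  have hz : (r, extChartAt I x₀ x) ∈ J ×ˢ (extChartAt I x₀).target :=
    ⟨hr, (extChartAt I x₀).map_source hx⟩
  have hasDerivAt_trace := hasDerivAt_radial hJ hz ((hG.contDiffOn_trace_chartWeingarten (m := 1)
    hJ (by norm_num) x₀).differentiableOn one_ne_zero _ hz)
  refine hasDerivAt_trace.congr_of_eventuallyEq ?_
  filter_upwards [hJ.mem_nhds hr] with t ht
  exact ((hG.of_le one_le_two).trace_chartWeingarten hJ ht hx).symm

theorem hasDerivAt_meanCurvature (hJ : IsOpen J) (hG : IsMetricFamily I 2 J G) (hr : r ∈ J)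
    (x : N) :
    HasDerivAt (fun t => meanCurvature I (radialMetric I G) (t, x))
      (-ricciRR I (radialMetric I G) (r, x) -
        (weingarten I (radialMetric I G) (r, x) ^ 2).trace) r := by
  refine (hG.hasDerivAt_meanCurvature_chart hJ hr (mem_extChartAt_source x)).congr_deriv ?_
  rw [hG.ricciRR_eq_chartWeingarten hJ hr, hG.weingarten_eq_chartWeingarten hJ hr]
  ring

end IsMetricFamily

theorem continuousOn_of_charts {F : ℝ × N → ℝ} {f : N → ℝ × EuclideanSpace ℝ (Fin d) → ℝ}
    (hJ : IsOpen J) (hf : ∀ x₀, ContinuousOn (f x₀) (J ×ˢ (extChartAt I x₀).target))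
    (hF : ∀ x₀, ∀ r ∈ J, ∀ x ∈ (extChartAt I x₀).source, F (r, x) = f x₀ (r, extChartAt I x₀ x)) :
    ContinuousOn F (J ×ˢ univ) := by
  rintro ⟨r, x⟩ hp
  have chart_continuous : ContinuousOn (fun p : ℝ × N => (p.1, extChartAt I x p.2))
      (J ×ˢ (extChartAt I x).source) :=
    continuousOn_fst.prodMk ((continuousOn_extChartAt x).comp continuousOn_snd fun p hp => hp.2)
  have continuousOn_source : ContinuousOn F (J ×ˢ (extChartAt I x).source) :=
    ((hf x).comp chart_continuous fun p hp => ⟨hp.1, (extChartAt I x).map_source hp.2⟩).congr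
      fun p hp => hF x p.1 hp.1 p.2 hp.2
  exact (continuousOn_source.continuousAt
    (prod_mem_nhds (hJ.mem_nhds hp.1) (extChartAt_source_mem_nhds x))).continuousWithinAt

namespace IsMetricFamily

variable [IsManifold I 1 N]

theorem continuousOn_meanCurvature (hJ : IsOpen J) (hG : IsMetricFamily I 1 J G) :
    ContinuousOn (meanCurvature I (radialMetric I G)) (J ×ˢ univ) :=
  continuousOn_of_charts hJ
    (fun x₀ => (hG.contDiffOn_trace_chartWeingarten (m := 0) hJ (by norm_num) x₀).continuousOn)
    fun _ _ hr _ hx => (hG.trace_chartWeingarten hJ hr hx).symm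

theorem continuousOn_trace_weingarten_sq (hJ : IsOpen J) (hG : IsMetricFamily I 1 J G) :
    ContinuousOn (fun p => (weingarten I (radialMetric I G) p ^ 2).trace) (J ×ˢ univ) := by
  refine continuousOn_of_charts hJ (f := fun x₀ z => (chartWeingarten I G x₀ z ^ 2).trace)
    (fun x₀ => ?_) fun _ _ hr _ hx => (hG.trace_chartWeingarten_sq hJ hr hx).symm
  have entry_continuous := fun i j =>
    (hG.contDiffOn_chartWeingarten (m := 0) hJ (by norm_num) x₀ i j).continuousOn
  simp only [sq, Matrix.trace, Matrix.diag_apply, Matrix.mul_apply]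
  exact continuousOn_finsetSum _ fun i _ => continuousOn_finsetSum _ fun j _ =>
    (entry_continuous i j).mul (entry_continuous j i)

theorem continuousOn_ricciRR (hJ : IsOpen J) (hG : IsMetricFamily I 2 J G) :
    ContinuousOn (ricciRR I (radialMetric I G)) (J ×ˢ univ) := by
  have deriv_continuous : ContinuousOn (fun p : ℝ × N =>
      deriv (fun t => meanCurvature I (radialMetric I G) (t, p.2)) p.1) (J ×ˢ univ) :=
    continuousOn_of_charts hJ
      (fun x₀ => (contDiffOn_coordDeriv (b := radialBasis d)
        (fun z hz => prod_target_eventuallyEq_range hJ hz)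
        (hG.contDiffOn_trace_chartWeingarten (m := 1) hJ (by norm_num) x₀)
        (m := 0) (by norm_num) (Sum.inl ())).continuousOn)
      fun _ _ hr _ hx => (hG.hasDerivAt_meanCurvature_chart hJ hr hx).deriv
  refine (deriv_continuous.neg.sub
    ((hG.of_le one_le_two).continuousOn_trace_weingarten_sq hJ)).congr fun p hp => ?_
  simp only [Pi.sub_apply, Pi.neg_apply, (hG.hasDerivAt_meanCurvature hJ hp.1 p.2).deriv]
  ring

end IsMetricFamily

end RadialCurvature

/-! ### Integration over the cylinder -/

section Interval

variable {a b : EReal}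

theorem isOpen_realIoo (a b : EReal) : IsOpen (realIoo a b) :=
  (isOpen_Ioo (a := a) (b := b)).preimage continuous_coe_real_ereal

theorem ordConnected_realIoo (a b : EReal) : OrdConnected (realIoo a b) :=
  ⟨fun _ hx _ hy _ hz => ⟨hx.1.trans_le (EReal.coe_le_coe_iff.2 hz.1),
    (EReal.coe_le_coe_iff.2 hz.2).trans_lt hy.2⟩⟩

theorem nonempty_realIoo (hab : a < b) : (realIoo a b).Nonempty :=
  EReal.lt_iff_exists_real_btwn.1 hab

theorem realIoo_mem_nhdsIoo (a b r₀ : EReal) : realIoo a b ∈ nhdsIoo a b r₀ :=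
  mem_comap.2 ⟨Ioo a b, self_mem_nhdsWithin, fun _ h => h⟩

instance (a b r₀ : EReal) : (nhdsIoo a b r₀).IsCountablyGenerated :=
  inferInstanceAs (comap _ _).IsCountablyGenerated

theorem nhdsIoo_neBot (hab : a < b) {r₀ : EReal} (hr₀ : r₀ ∈ Icc a b) :
    (nhdsIoo a b r₀).NeBot := by
  refine comap_neBot_iff.2 fun t ht => ?_
  obtain ⟨u, hu, hr₀u, hut⟩ := mem_nhdsWithin.1 ht
  have mem_closure : r₀ ∈ closure (Ioo a b) := by rwa [closure_Ioo hab.ne]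
  obtain ⟨y, hyu, hy⟩ := mem_closure_iff.1 mem_closure u hu hr₀u
  obtain ⟨l, w, hlw, subset⟩ := (mem_nhds_iff_exists_Ioo_subset' ⟨a, hy.1⟩ ⟨b, hy.2⟩).1
    ((hu.inter isOpen_Ioo).mem_nhds ⟨hyu, hy⟩)
  obtain ⟨z, hlz, hzy⟩ := EReal.lt_iff_exists_real_btwn.1 hlw.1
  exact ⟨z, hut (subset ⟨hlz, hzy.trans hlw.2⟩)⟩

theorem exists_seq_tendsto_nhdsIoo (hab : a < b) {r₀ : EReal} (hr₀ : r₀ ∈ Icc a b) :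
    ∃ u : ℕ → ℝ, Tendsto u atTop (nhdsIoo a b r₀) ∧ ∀ k, u k ∈ realIoo a b := by
  have := nhdsIoo_neBot hab hr₀
  exact exists_seq_forall_of_frequently
    (Eventually.frequently (realIoo_mem_nhdsIoo a b r₀))

theorem tendsto_coe_of_tendsto_nhdsIoo {ι : Type*} {l : Filter ι} {u : ι → ℝ} {r₀ : EReal}
    (hu : Tendsto u l (nhdsIoo a b r₀)) : Tendsto (fun k => (u k : EReal)) l (𝓝 r₀) :=
  (tendsto_comap_iff.1 hu).mono_right nhdsWithin_le_nhds

theorem eventually_mem_Icc_of_tendsto_nhdsIoo {ι : Type*} {l : Filter ι} {u v : ι → ℝ}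
    (hu : Tendsto u l (nhdsIoo a b a)) (hv : Tendsto v l (nhdsIoo a b b)) {r : ℝ}
    (hr : r ∈ realIoo a b) : ∀ᶠ k in l, r ∈ Icc (u k) (v k) := by
  filter_upwards [(tendsto_coe_of_tendsto_nhdsIoo hu).eventually_lt_const hr.1,
    (tendsto_coe_of_tendsto_nhdsIoo hv).eventually_const_lt hr.2] with k huk hvk
  exact ⟨EReal.coe_le_coe_iff.1 huk.le, EReal.coe_le_coe_iff.1 hvk.le⟩

end Interval

section Cylinder

variable {N : Type*} [MeasurableSpace N] {μ : Measure N} {a b : EReal}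

theorem aecover_Icc_prod_univ {ι : Type*} {l : Filter ι} {u v : ι → ℝ}
    (hu : Tendsto u l (nhdsIoo a b a)) (hv : Tendsto v l (nhdsIoo a b b)) :
    AECover ((volume.prod μ).restrict (realIoo a b ×ˢ univ)) l
      fun k => Icc (u k) (v k) ×ˢ (univ : Set N) where
  ae_eventually_mem := by
    filter_upwards [ae_restrict_mem ((isOpen_realIoo a b).measurableSet.prod .univ)] with p hp
    exact (eventually_mem_Icc_of_tendsto_nhdsIoo hu hv hp.1).mono fun k hk => ⟨hk, mem_univ _⟩
  measurableSet _ := measurableSet_Icc.prod .univ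

variable [TopologicalSpace N] [CompactSpace N] [OpensMeasurableSpace N] [IsFiniteMeasure μ]
  {m D Q F : ℝ × N → ℝ} {u v : ℝ}

theorem integrableOn_Icc_prod_univ (hF : ContinuousOn F (realIoo a b ×ˢ univ))
    (hu : u ∈ realIoo a b) (hv : v ∈ realIoo a b) :
    IntegrableOn F (Icc u v ×ˢ univ) (volume.prod μ) :=
  (hF.mono (prod_mono ((ordConnected_realIoo a b).out hu hv) subset_rfl)).integrableOn_compact'
    (isCompact_Icc.prod isCompact_univ) (measurableSet_Icc.prod .univ)

theorem integrable_slice (hF : ContinuousOn F (realIoo a b ×ˢ univ)) {r : ℝ}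
    (hr : r ∈ realIoo a b) : Integrable (fun x => F (r, x)) μ := by
  have slice_continuous : Continuous fun x => F (r, x) :=
    hF.comp_continuous (by fun_prop) fun x => ⟨hr, mem_univ x⟩
  rw [← integrableOn_univ]
  exact slice_continuous.continuousOn.integrableOn_compact' isCompact_univ .univ

theorem integral_sub_eq_setIntegral (hm : ContinuousOn m (realIoo a b ×ˢ univ))
    (hF : ContinuousOn F (realIoo a b ×ˢ univ))
    (hderiv : ∀ r ∈ realIoo a b, ∀ x, HasDerivAt (fun t => m (t, x)) (F (r, x)) r)
    (hu : u ∈ realIoo a b) (hv : v ∈ realIoo a b) (huv : u ≤ v) :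
    (∫ x, m (v, x) ∂μ) - ∫ x, m (u, x) ∂μ = ∫ p in Icc u v ×ˢ univ, F p ∂(volume.prod μ) := by
  have subset := (ordConnected_realIoo a b).out hu hv
  have prod_restrict : (volume.prod μ).restrict (Icc u v ×ˢ univ) =
      (volume.restrict (Icc u v)).prod μ := by
    rw [← Measure.prod_restrict, Measure.restrict_univ]
  have integrable : Integrable F ((volume.restrict (Icc u v)).prod μ) :=
    prod_restrict ▸ integrableOn_Icc_prod_univ hF hu hv
  have slice_integral : ∀ x, m (v, x) - m (u, x) = ∫ r in Icc u v, F (r, x) := fun x => by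
    have slice_continuous : ContinuousOn (fun r => F (r, x)) (uIcc u v) := by
      rw [uIcc_of_le huv]
      exact hF.comp (by fun_prop) fun r hr => ⟨subset hr, mem_univ x⟩
    rw [integral_Icc_eq_integral_Ioc, ← intervalIntegral.integral_of_le huv]
    refine (intervalIntegral.integral_eq_sub_of_hasDerivAt (fun r hr => hderiv r (subset ?_) x)
      slice_continuous.intervalIntegrable).symm
    rwa [uIcc_of_le huv] at hr
  rw [prod_restrict, integral_prod_symm _ integrable,
    ← integral_sub (integrable_slice hm hv) (integrable_slice hm hu)]
  exact integral_congr_ae (.of_forall slice_integral)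

variable (hm : ContinuousOn m (realIoo a b ×ˢ univ)) (hDc : ContinuousOn D (realIoo a b ×ˢ univ))
  (hQc : ContinuousOn Q (realIoo a b ×ˢ univ))
  (hderiv : ∀ r ∈ realIoo a b, ∀ x, HasDerivAt (fun t => m (t, x)) (D (r, x) + Q (r, x)) r)
  {Ma Mb : ℝ} (hMa : Tendsto (fun r => ∫ x, m (r, x) ∂μ) (nhdsIoo a b a) (𝓝 Ma))
  (hMb : Tendsto (fun r => ∫ x, m (r, x) ∂μ) (nhdsIoo a b b) (𝓝 Mb))
  (hD : IntegrableOn D (realIoo a b ×ˢ univ) (volume.prod μ))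

include hm hDc hQc hderiv hMa hMb hD

theorem tendsto_setIntegral_Icc_prod_univ {ι : Type*} {l : Filter ι} [l.IsCountablyGenerated]
    {u v : ι → ℝ} (hab : a < b) (hu : Tendsto u l (nhdsIoo a b a))
    (hv : Tendsto v l (nhdsIoo a b b)) :
    Tendsto (fun k => ∫ p in Icc (u k) (v k) ×ˢ univ, Q p ∂(volume.prod μ)) l
      (𝓝 (Mb - Ma - ∫ p in realIoo a b ×ˢ univ, D p ∂(volume.prod μ))) := by
  have D_tendsto := (aecover_Icc_prod_univ hu hv).integral_tendsto_of_countably_generated hD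
  refine (((hMb.comp hv).sub (hMa.comp hu)).sub D_tendsto).congr' ?_
  obtain ⟨r, hr⟩ := nonempty_realIoo hab
  filter_upwards [hu (realIoo_mem_nhdsIoo a b a), hv (realIoo_mem_nhdsIoo a b b),
    eventually_mem_Icc_of_tendsto_nhdsIoo hu hv hr] with k huk hvk hrk
  have subset : Icc (u k) (v k) ×ˢ (univ : Set N) ⊆ realIoo a b ×ˢ univ :=
    prod_mono ((ordConnected_realIoo a b).out huk hvk) subset_rfl
  rw [Function.comp_apply, Function.comp_apply,
    Measure.restrict_restrict_of_subset subset, sub_eq_iff_eq_add',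
    integral_sub_eq_setIntegral hm (hDc.add hQc) hderiv huk hvk (hrk.1.trans hrk.2)]
  exact integral_add (integrableOn_Icc_prod_univ hDc huk hvk)
    (integrableOn_Icc_prod_univ hQc huk hvk)

variable (hQ : ∀ p ∈ realIoo a b ×ˢ univ, 0 ≤ Q p)

include hQ

-- Monotone convergence: `Q` is nonnegative and its integrals over `[u, v] × N` converge.
theorem integrableOn_and_setIntegral_eq_sub (hab : a < b) :
    IntegrableOn Q (realIoo a b ×ˢ univ) (volume.prod μ) ∧
      ∫ p in realIoo a b ×ˢ univ, Q p ∂(volume.prod μ) =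
        Mb - Ma - ∫ p in realIoo a b ×ˢ univ, D p ∂(volume.prod μ) := by
  obtain ⟨u, hua, hu⟩ := exists_seq_tendsto_nhdsIoo hab ⟨le_rfl, hab.le⟩
  obtain ⟨v, hvb, hv⟩ := exists_seq_tendsto_nhdsIoo hab ⟨hab.le, le_rfl⟩
  have cover := aecover_Icc_prod_univ (μ := μ) hua hvb
  have restrict_restrict : ∀ k, ((volume.prod μ).restrict (realIoo a b ×ˢ univ)).restrict
      (Icc (u k) (v k) ×ˢ univ) = (volume.prod μ).restrict (Icc (u k) (v k) ×ˢ univ) := fun k =>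
    Measure.restrict_restrict_of_subset
      (prod_mono ((ordConnected_realIoo a b).out (hu k) (hv k)) subset_rfl)
  have integrable : ∀ k, IntegrableOn Q (Icc (u k) (v k) ×ˢ univ)
      ((volume.prod μ).restrict (realIoo a b ×ˢ univ)) := fun k => by
    rw [IntegrableOn, restrict_restrict]
    exact integrableOn_Icc_prod_univ hQc (hu k) (hv k)
  have nonneg : ∀ᵐ p ∂(volume.prod μ).restrict (realIoo a b ×ˢ univ), 0 ≤ Q p :=
    ae_restrict_of_forall_mem ((isOpen_realIoo a b).measurableSet.prod .univ) hQ
  have tendsto := tendsto_setIntegral_Icc_prod_univ hm hDc hQc hderiv hMa hMb hD hab hua hvb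
  simp only [← restrict_restrict] at tendsto
  have Q_integrable := cover.integrable_of_integral_tendsto_of_nonneg_ae _ integrable nonneg tendsto
  exact ⟨Q_integrable, cover.integral_eq_of_tendsto _ Q_integrable tendsto⟩

theorem setIntegral_le_sub (hab : a < b) :
    ∫ p in realIoo a b ×ˢ univ, D p ∂(volume.prod μ) ≤ Mb - Ma := by
  have := setIntegral_nonneg (μ := volume.prod μ)
    ((isOpen_realIoo a b).measurableSet.prod .univ) hQ
  rwa [(integrableOn_and_setIntegral_eq_sub hm hDc hQc hderiv hMa hMb hD hQ hab).2, sub_nonneg]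
    at this

theorem sub_eq_setIntegral_iff [μ.IsOpenPosMeasure] (hab : a < b) :
    Mb - Ma = ∫ p in realIoo a b ×ˢ univ, D p ∂(volume.prod μ) ↔
      ∀ p ∈ realIoo a b ×ˢ univ, Q p = 0 := by
  obtain ⟨Q_integrable, Q_integral⟩ :=
    integrableOn_and_setIntegral_eq_sub hm hDc hQc hderiv hMa hMb hD hQ hab
  have isOpen : IsOpen (realIoo a b ×ˢ (univ : Set N)) := (isOpen_realIoo a b).prod isOpen_univ
  rw [← sub_eq_zero, ← Q_integral,
    setIntegral_eq_zero_iff_of_nonneg_ae (ae_restrict_of_forall_mem isOpen.measurableSet hQ)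
      Q_integrable]
  exact ⟨fun ae_zero => Measure.eqOn_open_of_ae_eq ae_zero isOpen hQc continuousOn_const,
    ae_restrict_of_forall_mem isOpen.measurableSet⟩

end Cylinder

/-! ### The Riemannian measure -/

section CoordinateChange

variable {V : Type*} [NormedAddCommGroup V] [NormedSpace ℝ V]
  {H : Type*} [TopologicalSpace H] {I : ModelWithCorners ℝ V H}
  {N : Type*} [TopologicalSpace N] [ChartedSpace H N] [IsManifold I 1 N]
  {p q : N} {z : V}

theorem differentiableWithinAt_extChartAt_comp_symm (hz : z ∈ (extChartAt I p).target)
    (hq : (extChartAt I p).symm z ∈ (extChartAt I q).source) :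
    DifferentiableWithinAt ℝ (extChartAt I q ∘ (extChartAt I p).symm) (range I) z :=
  (contDiffWithinAt_ext_coord_change (n := 1) q p ⟨hz, hq⟩).differentiableWithinAt one_ne_zero

theorem mfderivWithin_extChartAt_symm_eq_comp (hz : z ∈ (extChartAt I p).target)
    (hq : (extChartAt I p).symm z ∈ (extChartAt I q).source) :
    (mfderivWithin 𝓘(ℝ, V) I (extChartAt I p).symm (range I) z : V →L[ℝ] V) =
      (mfderivWithin 𝓘(ℝ, V) I (extChartAt I q).symm (range I)
        (extChartAt I q ((extChartAt I p).symm z)) : V →L[ℝ] V).comp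
      (fderivWithin ℝ (extChartAt I q ∘ (extChartAt I p).symm) (range I) z) := by
  have deriv_change :=
    (differentiableWithinAt_extChartAt_comp_symm hz hq).hasFDerivWithinAt.hasMFDerivWithinAt
  have deriv_symm := (mdifferentiableWithinAt_extChartAt_symm (I := I)
    ((extChartAt I q).map_source hq)).hasMFDerivWithinAt
  have symm_eventuallyEq : (extChartAt I p).symm =ᶠ[𝓝[range I] z]
      (extChartAt I q).symm ∘ (extChartAt I q ∘ (extChartAt I p).symm) := by
    filter_upwards [(continuousAt_extChartAt_symm'' hz).continuousWithinAt
      ((isOpen_extChartAt_source q).mem_nhds hq)] with y hy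
    exact ((extChartAt I q).left_inv hy).symm
  refine ((HasMFDerivWithinAt.comp (s := range I) z deriv_symm deriv_change fun y _ => ?_
    ).congr_of_eventuallyEq symm_eventuallyEq ((extChartAt I q).left_inv hq).symm).mfderivWithin
      (I.uniqueMDiffOn z (extChartAt_target_subset_range p hz))
  simp only [mem_preimage, Function.comp, mfld_simps]

variable {ι : Type*} [Fintype ι] [DecidableEq ι] (b : Module.Basis ι ℝ V)

theorem coordMatrix_eq_transpose_mul_mul (γ : BilinField I N) (hz : z ∈ (extChartAt I p).target)
    (hq : (extChartAt I p).symm z ∈ (extChartAt I q).source) :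
    coordMatrix I b γ p z =
      (LinearMap.toMatrix b b (fderivWithin ℝ (extChartAt I q ∘ (extChartAt I p).symm)
        (range I) z).toLinearMap).transpose *
      coordMatrix I b γ q (extChartAt I q ((extChartAt I p).symm z)) *
      LinearMap.toMatrix b b (fderivWithin ℝ (extChartAt I q ∘ (extChartAt I p).symm)
        (range I) z).toLinearMap := by
  have coordMatrix_eq : ∀ (p : N) (z : V) (L : V →L[ℝ] V),
      L = mfderivWithin 𝓘(ℝ, V) I (extChartAt I p).symm (range I) z → coordMatrix I b γ p z =
      formMatrix b (ContinuousLinearMap.bilinearComp (E := V) (F := V)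
        (γ ((extChartAt I p).symm z)) L L) := by
    rintro p z _ rfl
    rfl
  rw [coordMatrix_eq p z _ (mfderivWithin_extChartAt_symm_eq_comp hz hq).symm,
    coordMatrix_eq q _ _ rfl, (extChartAt I q).left_inv hq, ← formMatrix_bilinearComp]
  rfl

end CoordinateChange

section ChartVolume

variable {d : ℕ} {H : Type*} [TopologicalSpace H]
  {I : ModelWithCorners ℝ (EuclideanSpace ℝ (Fin d)) H}
  {N : Type*} [TopologicalSpace N] [ChartedSpace H N]

/-- The volume density `√(det g_{AB})` in the chart around `p`. -/
def chartDensity (γ : BilinField I N) (p : N) (z : EuclideanSpace ℝ (Fin d)) : ℝ :=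
  √(coordMatrix I (stdBasis d) γ p z).det

theorem chartDensity_eq_mul [IsManifold I 1 N] (γ : BilinField I N) {p q : N}
    {z : EuclideanSpace ℝ (Fin d)} (hz : z ∈ (extChartAt I p).target)
    (hq : (extChartAt I p).symm z ∈ (extChartAt I q).source) :
    chartDensity γ p z =
      |(fderivWithin ℝ (extChartAt I q ∘ (extChartAt I p).symm) (range I) z).det| *
        chartDensity γ q (extChartAt I q ((extChartAt I p).symm z)) := by
  rw [chartDensity, coordMatrix_eq_transpose_mul_mul _ γ hz hq, Matrix.det_mul, Matrix.det_mul,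
    Matrix.det_transpose, mul_right_comm, ← sq, Real.sqrt_mul (sq_nonneg _), Real.sqrt_sq_eq_abs,
    LinearMap.det_toMatrix, chartDensity, ContinuousLinearMap.det]

theorem continuousOn_chartDensity [IsManifold I ∞ N] (γ : Metric I N) (p : N) :
    ContinuousOn (chartDensity γ.inner p) (extChartAt I p).target := by
  have h := contDiffOn_coordMatrix (b := stdBasis d) γ.contMDiff.contMDiffOn (s := univ) p
  simp only [preimage_univ, inter_univ] at h
  exact (contDiffOn_matrix_det h).continuousOn.sqrt

theorem chartDensity_pos [IsManifold I ∞ N] (γ : Metric I N) {p : N}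
    {z : EuclideanSpace ℝ (Fin d)} (hz : z ∈ (extChartAt I p).target) :
    0 < chartDensity γ.inner p z := by
  obtain ⟨c, hc⟩ := exists_basis_coordMatrix_eq (b := stdBasis d) ((extChartAt I p).map_target hz)
  rw [(extChartAt I p).right_inv hz] at hc
  rw [chartDensity, hc]
  exact Real.sqrt_pos.2 (posDef_formMatrix c (γ.symm _) (γ.pos _)).det_pos

theorem measurableSet_extChartAt_target (p : N) : MeasurableSet (extChartAt I p).target := by
  rw [extChartAt_target]
  exact ((chartAt H p).open_target.preimage I.continuous_symm).measurableSet.inter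
    I.isClosed_range.measurableSet

variable [MeasurableSpace N] [BorelSpace N]

theorem measurableSet_target_inter_preimage (p : N) {s : Set N} (hs : MeasurableSet s) :
    MeasurableSet ((extChartAt I p).target ∩ (extChartAt I p).symm ⁻¹' s) := by
  have h := (measurableSet_extChartAt_target (I := I) p).subtype_image
    ((continuousOn_extChartAt_symm (I := I) p).domRestrict.measurable hs)
  rwa [domRestrict_eq, preimage_comp, Subtype.image_preimage_coe] at h

theorem chartVolume_apply (γ : BilinField I N) (p : N) {s : Set N} (hs : MeasurableSet s) :
    chartVolume I γ p s = ∫⁻ z in (extChartAt I p).target ∩ (extChartAt I p).symm ⁻¹' s,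
      ENNReal.ofReal (chartDensity γ p z) := by
  have ht := measurableSet_extChartAt_target (I := I) p
  rw [chartVolume, Measure.map_apply_of_aemeasurable
      (((continuousOn_extChartAt_symm p).aemeasurable ht).mono_ac
        (withDensity_absolutelyContinuous _ _)) hs, withDensity_apply',
    Measure.restrict_restrict' ht, inter_comm]
  rfl

theorem chartVolume_inter_source (γ : BilinField I N) (p : N) {s : Set N} (hs : MeasurableSet s) :
    chartVolume I γ p (s ∩ (extChartAt I p).source) = chartVolume I γ p s := by
  rw [chartVolume_apply γ p hs,
    chartVolume_apply γ p (hs.inter (isOpen_extChartAt_source p).measurableSet), preimage_inter,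
    inter_left_comm, inter_eq_self_of_subset_left (extChartAt I p).target_subset_preimage_source,
    inter_comm]

theorem chartVolume_eq_of_subset [IsManifold I 1 N] (γ : BilinField I N) {p q : N} {s : Set N}
    (hs : MeasurableSet s) (hp : s ⊆ (extChartAt I p).source) (hq : s ⊆ (extChartAt I q).source) :
    chartVolume I γ p s = chartVolume I γ q s := by
  rw [chartVolume_apply γ p hs, chartVolume_apply γ q hs]
  set S := (extChartAt I p).target ∩ (extChartAt I p).symm ⁻¹' s
  set T := extChartAt I q ∘ (extChartAt I p).symm
  have image_eq : T '' S = (extChartAt I q).target ∩ (extChartAt I q).symm ⁻¹' s := by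
    rw [image_comp, show S = _ from ((extChartAt I p).image_eq_target_inter_inv_preimage hp).symm,
      (extChartAt I p).symm_image_image_of_subset_source hp,
      (extChartAt I q).image_eq_target_inter_inv_preimage hq]
  have injOn : InjOn T S := (extChartAt I q).injOn.comp
    ((extChartAt I p).symm.injOn.mono inter_subset_left) fun z hz => hq hz.2
  have hasDeriv : ∀ z ∈ S, HasFDerivWithinAt T (fderivWithin ℝ T (range I) z) S z := fun z hz =>
    (differentiableWithinAt_extChartAt_comp_symm hz.1 (hq hz.2)).hasFDerivWithinAt.mono
      (inter_subset_left.trans (extChartAt_target_subset_range p))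
  have hS : MeasurableSet S := measurableSet_target_inter_preimage p hs
  rw [← image_eq, lintegral_image_eq_lintegral_abs_det_fderiv_mul volume hS hasDeriv injOn]
  refine setLIntegral_congr_fun hS fun z hz => ?_
  rw [chartDensity_eq_mul γ hz.1 (hq hz.2), ENNReal.ofReal_mul (abs_nonneg _)]
  rfl

end ChartVolume

theorem exists_isOpen_subset_target_inter_preimage {d : ℕ} {H : Type*} [TopologicalSpace H]
    {I : ModelWithCorners ℝ (EuclideanSpace ℝ (Fin d)) H} {N : Type*} [TopologicalSpace N]
    [ChartedSpace H N] {U : Set N} (hU : IsOpen U) {x : N} (hx : x ∈ U) :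
    ∃ O, IsOpen O ∧ O.Nonempty ∧ O ⊆ (extChartAt I x).target ∩ (extChartAt I x).symm ⁻¹' U := by
  obtain ⟨O, hO, hxO, hOs⟩ : ∃ O, IsOpen O ∧ extChartAt I x x ∈ O ∧
      O ∩ range I ⊆ (extChartAt I x).target ∩ (extChartAt I x).symm ⁻¹' U := by
    refine mem_nhdsWithin.1 (inter_mem (extChartAt_target_mem_nhdsWithin x) ?_)
    exact (continuousAt_extChartAt_symm x).continuousWithinAt
      (by rw [extChartAt_to_inv]; exact hU.mem_nhds hx)
  exact ⟨O ∩ interior (range I), hO.inter isOpen_interior,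
    mem_closure_iff.1 (I.range_subset_closure_interior
      (extChartAt_target_subset_range x (mem_extChartAt_target x))) O hO hxO,
    (inter_subset_inter_right _ interior_subset).trans hOs⟩

section RiemannianMeasure

variable {d : ℕ} {H : Type*} [TopologicalSpace H]
  {I : ModelWithCorners ℝ (EuclideanSpace ℝ (Fin d)) H}
  {N : Type*} [TopologicalSpace N] [ChartedSpace H N] [MeasurableSpace N] [BorelSpace N]

theorem riemannianMeasure_apply_of_subset_source [IsManifold I 1 N] (γ : BilinField I N) {x : N}
    {s : Set N} (hs : MeasurableSet s) (hsx : s ⊆ (extChartAt I x).source) :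
    riemannianMeasure I γ s = chartVolume I γ x s := by
  have hx : MeasurableSet (extChartAt I x).source := (isOpen_extChartAt_source x).measurableSet
  -- On the domain of the chart around `x` the chart measures are dominated by that of `x`; the
  -- infinite measure takes care of the rest of `N`.
  have riemannianMeasure_le : riemannianMeasure I γ ≤
      chartVolume I γ x + (⊤ : Measure N).restrict (extChartAt I x).sourceᶜ := by
    refine iSup_le fun p => Measure.le_iff.2 fun t ht => ?_
    rw [← measure_inter_add_sdiff t hx, Measure.add_apply, Measure.restrict_apply ht]
    refine add_le_add ?_ (le_top (a := chartVolume I γ p) _)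
    rw [← chartVolume_inter_source γ p (ht.inter hx), chartVolume_eq_of_subset γ
      ((ht.inter hx).inter (isOpen_extChartAt_source p).measurableSet) inter_subset_right
      (inter_subset_left.trans inter_subset_right)]
    exact measure_mono (inter_subset_left.trans inter_subset_left)
  refine le_antisymm ((riemannianMeasure_le s).trans_eq ?_)
    (le_iSup (fun p => chartVolume I γ p) x s)
  rw [Measure.add_apply, Measure.restrict_apply hs, ← sdiff_eq, sdiff_eq_empty.2 hsx, measure_empty,
    add_zero]

variable [IsManifold I ∞ N] (γ : Metric I N)

instance isLocallyFiniteMeasure_riemannianMeasure :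
    IsLocallyFiniteMeasure (riemannianMeasure I γ.inner) := by
  refine ⟨fun x => ?_⟩
  obtain ⟨W, hW, hWfin⟩ : IntegrableAtFilter (chartDensity γ.inner x)
      (𝓝[(extChartAt I x).target] (extChartAt I x x)) :=
    (continuousOn_chartDensity γ x).integrableAt_nhdsWithin (measurableSet_extChartAt_target x)
      (mem_extChartAt_target x)
  have preimage_mem : (extChartAt I x).source ∩ extChartAt I x ⁻¹' W ∈ 𝓝 x := by
    refine inter_mem (extChartAt_source_mem_nhds x) ?_
    rw [nhdsWithin_extChartAt_target_eq, ← map_extChartAt_nhds] at hW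
    exact hW
  obtain ⟨U, hUW, hU, hxU⟩ := mem_nhds_iff.1 preimage_mem
  refine ⟨U, hU.mem_nhds hxU, ?_⟩
  rw [riemannianMeasure_apply_of_subset_source γ.inner hU.measurableSet
    (hUW.trans inter_subset_left), chartVolume_apply _ _ hU.measurableSet]
  refine (hWfin.mono_set fun z hz => ?_).lintegral_lt_top
  simpa only [mem_preimage, (extChartAt I x).right_inv hz.1] using (hUW hz.2).2

instance isOpenPosMeasure_riemannianMeasure :
    (riemannianMeasure I γ.inner).IsOpenPosMeasure := by
  refine ⟨fun U hU ⟨x, hx⟩ measure_eq_zero => ?_⟩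
  have integral_eq_zero : ∫⁻ z in (extChartAt I x).target ∩ (extChartAt I x).symm ⁻¹' U,
      ENNReal.ofReal (chartDensity γ.inner x z) = 0 := by
    rw [← chartVolume_apply _ _ hU.measurableSet]
    exact le_antisymm
      (measure_eq_zero ▸ le_iSup (fun p => chartVolume I γ.inner p) x U) zero_le
  obtain ⟨O, isOpen, nonempty, subset⟩ :=
    exists_isOpen_subset_target_inter_preimage (I := I) hU hx
  have density_measurable : AEMeasurable (fun z => ENNReal.ofReal (chartDensity γ.inner x z))
      (volume.restrict O) :=
    (((continuousOn_chartDensity γ x).mono (subset.trans inter_subset_left)).aemeasurable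
      isOpen.measurableSet).ennreal_ofReal
  have density_ae_zero := (lintegral_eq_zero_iff' density_measurable).1
    (le_antisymm (integral_eq_zero ▸ lintegral_mono_set subset) zero_le)
  refine isOpen.measure_ne_zero volume nonempty
    (ae_restrict_eq_bot.1 (eventually_false_iff_eq_bot.1 ?_))
  filter_upwards [density_ae_zero, ae_restrict_mem isOpen.measurableSet] with z hz hzO
  exact (ENNReal.ofReal_pos.2 (chartDensity_pos γ (subset hzO).1)).ne' hz

end RiemannianMeasure

section RadialMassDerivative

variable {d : ℕ} {H : Type*} [TopologicalSpace H]
  {I : ModelWithCorners ℝ (EuclideanSpace ℝ (Fin d)) H}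
  {N : Type*} [TopologicalSpace N] [ChartedSpace H N]
  {J : Set ℝ} {k : WithTop ℕ∞} {G : ℝ → BilinField I N} {Ghat : BilinField I N}
  {h : ℝ → ℝ} {r : ℝ}

/-! ### Umbilic level sets -/

namespace IsMetricFamily

theorem isSymm_familyDeriv (hJ : IsOpen J) (hG : IsMetricFamily I k J G) {x₀ : N}
    {z : ℝ × EuclideanSpace ℝ (Fin d)} (hz : z ∈ J ×ˢ (extChartAt I x₀).target) :
    (familyDeriv I G x₀ z).IsSymm :=
  Matrix.IsSymm.ext fun _ _ => coordDeriv_congr (prod_target_eventuallyEq_range hJ hz) hz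
    (fun y hy => hG.symm y.1 hy.1 _ _ _) _

variable [IsManifold I 1 N]

theorem weingarten_sub_smul_one (hJ : IsOpen J) (hG : IsMetricFamily I k J G) (hr : r ∈ J)
    (x : N) (c : ℝ) :
    weingarten I (radialMetric I G) (r, x) - c • 1 =
      (coordMatrix I (stdBasis d) (G r) x (extChartAt I x x))⁻¹ *
        ((1 / 2 : ℝ) • familyDeriv I G x (r, extChartAt I x x) -
          c • coordMatrix I (stdBasis d) (G r) x (extChartAt I x x)) := by
  have hz : (r, extChartAt I x x) ∈ J ×ˢ (extChartAt I x).target := ⟨hr, mem_extChartAt_target x⟩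
  rw [hG.weingarten_eq_chartWeingarten hJ hr, chartWeingarten, hG.isSymm_familyDeriv hJ hz,
    Matrix.mul_sub, Matrix.mul_smul, Matrix.mul_smul,
    Matrix.nonsing_inv_mul _ (hG.isUnit_det_coordMatrix hz)]

theorem weingarten_eq_smul_one_iff (hJ : IsOpen J) (hG : IsMetricFamily I k J G) (hr : r ∈ J)
    (x : N) (c : ℝ) :
    weingarten I (radialMetric I G) (r, x) = c • 1 ↔
      familyDeriv I G x (r, extChartAt I x x) =
        (2 * c) • coordMatrix I (stdBasis d) (G r) x (extChartAt I x x) := by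
  have isUnit_inv := Matrix.isUnit_nonsing_inv_iff.2 <| (Matrix.isUnit_iff_isUnit_det _).2 <|
    hG.isUnit_det_coordMatrix (z := (r, extChartAt I x x)) ⟨hr, mem_extChartAt_target x⟩
  rw [← sub_eq_zero, hG.weingarten_sub_smul_one hJ hr, isUnit_inv.mul_right_eq_zero, sub_eq_zero,
    one_div, inv_smul_eq_iff₀ two_ne_zero, smul_smul]

theorem exists_posDef_trace_weingarten_sub_smul_one_sq_eq (hJ : IsOpen J)
    (hG : IsMetricFamily I k J G) (hr : r ∈ J) (x : N) (c : ℝ) :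
    ∃ A K : Matrix (Fin d) (Fin d) ℝ, A.PosDef ∧
      weingarten I (radialMetric I G) (r, x) - c • 1 = A⁻¹ * K ∧
      ((weingarten I (radialMetric I G) (r, x) - c • 1) ^ 2).trace =
        (A⁻¹ * K * A⁻¹ * K.transpose).trace := by
  have hz : (r, extChartAt I x x) ∈ J ×ˢ (extChartAt I x).target := ⟨hr, mem_extChartAt_target x⟩
  have hA := hG.posDef_coordMatrix hz
  have isSymm_coordMatrix : (coordMatrix I (stdBasis d) (G r) x (extChartAt I x x)).IsSymm :=
    hA.isHermitian
  refine ⟨_, _, hA, hG.weingarten_sub_smul_one hJ hr x c, ?_⟩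
  rw [hG.weingarten_sub_smul_one hJ hr, sq, ← Matrix.mul_assoc,
    (((hG.isSymm_familyDeriv hJ hz).smul _).sub (isSymm_coordMatrix.smul _)).eq]

theorem trace_weingarten_sub_smul_one_sq_nonneg (hJ : IsOpen J) (hG : IsMetricFamily I k J G)
    (hr : r ∈ J) (x : N) (c : ℝ) :
    0 ≤ ((weingarten I (radialMetric I G) (r, x) - c • 1) ^ 2).trace := by
  obtain ⟨A, K, hA, -, htrace⟩ := hG.exists_posDef_trace_weingarten_sub_smul_one_sq_eq hJ hr x c
  exact htrace ▸ trace_inv_mul_mul_inv_mul_transpose_nonneg hA K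

theorem trace_weingarten_sub_smul_one_sq_eq_zero_iff (hJ : IsOpen J)
    (hG : IsMetricFamily I k J G) (hr : r ∈ J) (x : N) (c : ℝ) :
    ((weingarten I (radialMetric I G) (r, x) - c • 1) ^ 2).trace = 0 ↔
      weingarten I (radialMetric I G) (r, x) = c • 1 := by
  obtain ⟨A, K, hA, hsub, htrace⟩ := hG.exists_posDef_trace_weingarten_sub_smul_one_sq_eq hJ hr x c
  rw [htrace, trace_inv_mul_mul_inv_mul_transpose_eq_zero_iff hA,
    ← sub_eq_zero (a := weingarten I (radialMetric I G) (r, x)), hsub,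
    (Matrix.isUnit_nonsing_inv_iff.2 hA.isUnit).mul_right_eq_zero]

end IsMetricFamily

/-! ### Conformal families -/

theorem hasDerivAt_div_sq {f : ℝ → ℝ} {f' h' : ℝ} (hf : HasDerivAt f f' r)
    (hh : HasDerivAt h h' r) (hr : h r ≠ 0) :
    HasDerivAt (fun t => f t / h t ^ 2) ((f' - 2 * (h' / h r) * f r) / h r ^ 2) r := by
  refine (hf.div (hh.fun_pow 2) (pow_ne_zero 2 hr)).congr_deriv ?_
  field_simp
  ring

namespace IsMetricFamily

variable [IsManifold I 1 N]

theorem weingarten_eq_of_eq_sq_smul (hJ : IsOpen J) (hG : IsMetricFamily I 1 J G)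
    (hh : DifferentiableOn ℝ h J) (hpos : ∀ r ∈ J, 0 < h r) (hr : r ∈ J)
    {Γ : BilinField I N} (hGΓ : ∀ t ∈ J, ∀ x, G t x = h t ^ 2 • Γ x) (x : N) :
    weingarten I (radialMetric I G) (r, x) = (deriv h r / h r) • 1 := by
  rw [hG.weingarten_eq_smul_one_iff hJ hr]
  ext A C
  have deriv_family := hasDerivAt_coordMatrix hJ hG.contDiff
    (z := (r, extChartAt I x x)) ⟨hr, mem_extChartAt_target x⟩ A C
  have quotient_const : (fun t => coordMatrix I (stdBasis d) (G t) x (extChartAt I x x) A C /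
      h t ^ 2) =ᶠ[𝓝 r] fun _ => coordMatrix I (stdBasis d) Γ x (extChartAt I x x) A C := by
    filter_upwards [hJ.mem_nhds hr] with t ht
    rw [div_eq_iff (pow_pos (hpos t ht) 2).ne', mul_comm]
    exact congrArg (fun γ : EuclideanSpace ℝ (Fin d) →L[ℝ] EuclideanSpace ℝ (Fin d) →L[ℝ] ℝ =>
      γ (coordVec I (stdBasis d) x (extChartAt I x x) A)
        (coordVec I (stdBasis d) x (extChartAt I x x) C)) (hGΓ t ht _)
  have quotient_deriv := (hasDerivAt_div_sq deriv_family
    (hh.differentiableAt (hJ.mem_nhds hr)).hasDerivAt (hpos r hr).ne').unique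
      ((hasDerivAt_const r _).congr_of_eventuallyEq quotient_const)
  exact sub_eq_zero.1 ((div_eq_zero_iff.1 quotient_deriv).resolve_right
    (pow_pos (hpos r hr) 2).ne')

theorem eq_sq_smul_of_weingarten_eq (hJ : IsOpen J) (hJ' : IsPreconnected J)
    (hG : IsMetricFamily I 1 J G) (hh : DifferentiableOn ℝ h J) (hpos : ∀ r ∈ J, 0 < h r)
    (hW : ∀ r ∈ J, ∀ x,
      weingarten I (radialMetric I G) (r, x) = (deriv h r / h r) • 1)
    {s : ℝ} (hs : s ∈ J) (hr : r ∈ J) (x : N) :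
    G r x = h r ^ 2 • (h s ^ 2)⁻¹ • G s x := by
  obtain ⟨c, hc⟩ := exists_basis_coordMatrix_eq (b := stdBasis d) (mem_extChartAt_source (I := I) x)
  refine formMatrix_injective c (Matrix.ext fun A C => ?_)
  set f : ℝ → ℝ := fun t => coordMatrix I (stdBasis d) (G t) x (extChartAt I x x) A C
  have f_eq : ∀ t, f t = formMatrix c (G t x) A C := fun t => congrFun₂ (hc (G t)) A C
  have deriv_quotient : ∀ t ∈ J, HasDerivAt (fun t => f t / h t ^ 2) 0 t := fun t ht => by
    have deriv_family := hasDerivAt_coordMatrix hJ hG.contDiff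
      (z := (t, extChartAt I x x)) ⟨ht, mem_extChartAt_target x⟩ A C
    refine (hasDerivAt_div_sq deriv_family
      (hh.differentiableAt (hJ.mem_nhds ht)).hasDerivAt (hpos t ht).ne').congr_deriv ?_
    rw [(hG.weingarten_eq_smul_one_iff hJ ht x _).1 (hW t ht x), Matrix.smul_apply, smul_eq_mul,
      sub_self, zero_div]
  have quotient_eq : f r / h r ^ 2 = f s / h s ^ 2 := hJ.is_const_of_deriv_eq_zero hJ'
    (fun t ht => (deriv_quotient t ht).differentiableAt.differentiableWithinAt)
    (fun t ht => (deriv_quotient t ht).deriv) hr hs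
  rw [div_eq_iff (pow_pos (hpos r hr) 2).ne', f_eq, f_eq, div_eq_inv_mul, mul_comm] at quotient_eq
  exact quotient_eq

theorem weingarten_eq_iff_exists_eq_sq_smul (hJ : IsOpen J) (hJ' : IsPreconnected J)
    (hJne : J.Nonempty) (hG : IsMetricFamily I 1 J G) (hh : DifferentiableOn ℝ h J)
    (hpos : ∀ r ∈ J, 0 < h r) :
    (∀ r ∈ J, ∀ x, weingarten I (radialMetric I G) (r, x) = (deriv h r / h r) • 1) ↔
      ∃ Γ : BilinField I N, ∀ r ∈ J, ∀ x, G r x = h r ^ 2 • Γ x := by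
  obtain ⟨s, hs⟩ := hJne
  exact ⟨fun hW => ⟨_, fun r hr x => hG.eq_sq_smul_of_weingarten_eq hJ hJ' hh hpos hW hs hr x⟩,
    fun ⟨_, hΓ⟩ r hr x => hG.weingarten_eq_of_eq_sq_smul hJ hh hpos hr hΓ x⟩

end IsMetricFamily

theorem IsMetricFamily.sq_smul (hGhat : IsMetricFamily I k J fun _ => Ghat)
    (hh : ContDiffOn ℝ k h J) (hpos : ∀ r ∈ J, 0 < h r) :
    IsMetricFamily I k J fun r x => h r ^ 2 • Ghat x where
  contDiff x₀ i j :=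
    ((hh.comp contDiffOn_fst fun _ hz => hz.1).pow 2).mul (hGhat.contDiff x₀ i j)
  symm r hr x v w := congrArg (h r ^ 2 * ·) (hGhat.symm r hr x v w)
  pos r hr x v hv := mul_pos (pow_pos (hpos r hr) 2) (hGhat.pos r hr x v hv)

theorem weingarten_warpedMetric [IsManifold I 1 N] (hJ : IsOpen J)
    (hGhat : IsMetricFamily I 1 J fun _ => Ghat) (hh : ContDiffOn ℝ 1 h J)
    (hpos : ∀ r ∈ J, 0 < h r) (hr : r ∈ J) (x : N) :
    weingarten I (warpedMetric I h Ghat) (r, x) = (deriv h r / h r) • 1 :=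
  (hGhat.sq_smul hh hpos).weingarten_eq_of_eq_sq_smul hJ (hh.differentiableOn one_ne_zero) hpos hr
    (fun _ _ _ => rfl) x

/-! ### Variation of the radial mass -/

/-- The square norm `h² |S - (h'/h) 1|² = h² tr (S - (h'/h) 1)²` measuring how far the Weingarten
map `S` of `dr² + G(r)` is from that of `dr² + h(r)² Ĝ`. -/
def shapeDefect (I : ModelWithCorners ℝ (EuclideanSpace ℝ (Fin d)) H) (G : ℝ → BilinField I N)
    (h : ℝ → ℝ) (p : ℝ × N) : ℝ :=
  h p.1 ^ 2 * ((weingarten I (radialMetric I G) p - (deriv h p.1 / h p.1) • 1) ^ 2).trace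

variable [IsManifold I 1 N]

theorem shapeDefect_nonneg (hJ : IsOpen J) (hG : IsMetricFamily I k J G) (hr : r ∈ J) (x : N) :
    0 ≤ shapeDefect I G h (r, x) :=
  mul_nonneg (sq_nonneg _) (hG.trace_weingarten_sub_smul_one_sq_nonneg hJ hr x _)

theorem shapeDefect_eq_zero_iff (hJ : IsOpen J) (hG : IsMetricFamily I k J G) (hr : r ∈ J)
    (hh : h r ≠ 0) (x : N) :
    shapeDefect I G h (r, x) = 0 ↔
      weingarten I (radialMetric I G) (r, x) = (deriv h r / h r) • 1 :=
  (mul_eq_zero_iff_left (pow_ne_zero 2 hh)).trans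
    (hG.trace_weingarten_sub_smul_one_sq_eq_zero_iff hJ hr x _)

theorem hasDerivAt_radialMass (hJ : IsOpen J) (hG : IsMetricFamily I 2 J G)
    (hGhat : IsMetricFamily I 2 J fun _ => Ghat) (hh : ContDiffOn ℝ 2 h J)
    (hpos : ∀ r ∈ J, 0 < h r) (hr : r ∈ J) (x : N) :
    HasDerivAt (fun t => radialMass I (radialMetric I G) h Ghat (t, x))
      (ricciDefect I (radialMetric I G) h Ghat (r, x) + shapeDefect I G h (r, x)) r := by
  have hW := weingarten_warpedMetric hJ (hGhat.of_le one_le_two) (hh.of_le one_le_two) hpos hr x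
  have hW_trace : (weingarten I (warpedMetric I h Ghat) (r, x)).trace = d * (deriv h r / h r) := by
    rw [hW, Matrix.trace_smul, Matrix.trace_one, Fintype.card_fin, smul_eq_mul,
      mul_comm]
  have hW_sq : (weingarten I (warpedMetric I h Ghat) (r, x) ^ 2).trace =
      d * (deriv h r / h r) ^ 2 := by
    rw [hW, smul_pow, one_pow, Matrix.trace_smul, Matrix.trace_one, Fintype.card_fin, smul_eq_mul,
      mul_comm]
  have deriv_h : HasDerivAt h (deriv h r) r :=
    ((hh.differentiableOn two_ne_zero).differentiableAt (hJ.mem_nhds hr)).hasDerivAt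
  have deriv_warped : HasDerivAt (fun t => meanCurvature I (warpedMetric I h Ghat) (t, x))
      (-ricciRR I (warpedMetric I h Ghat) (r, x) -
        (weingarten I (warpedMetric I h Ghat) (r, x) ^ 2).trace) r :=
    (hGhat.sq_smul hh hpos).hasDerivAt_meanCurvature hJ hr x
  refine ((deriv_h.fun_pow 2).mul
    (deriv_warped.sub (hG.hasDerivAt_meanCurvature hJ hr x))).congr_deriv ?_
  have hne := (hpos r hr).ne'
  simp only [Pi.sub_apply, ricciDefect, shapeDefect, trace_sub_smul_one_sq, meanCurvature,
    hW_trace, hW_sq, Fintype.card_fin]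
  field_simp
  ring

theorem continuousOn_radialMass (hJ : IsOpen J) (hG : IsMetricFamily I 1 J G)
    (hGhat : IsMetricFamily I 1 J fun _ => Ghat) (hh : ContDiffOn ℝ 1 h J)
    (hpos : ∀ r ∈ J, 0 < h r) :
    ContinuousOn (radialMass I (radialMetric I G) h Ghat) (J ×ˢ univ) :=
  ((hh.continuousOn.comp continuousOn_fst fun _ hp => hp.1).pow 2).mul
    (((hGhat.sq_smul hh hpos).continuousOn_meanCurvature hJ).sub (hG.continuousOn_meanCurvature hJ))

theorem continuousOn_ricciDefect (hJ : IsOpen J) (hG : IsMetricFamily I 2 J G)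
    (hGhat : IsMetricFamily I 2 J fun _ => Ghat) (hh : ContDiffOn ℝ 2 h J)
    (hpos : ∀ r ∈ J, 0 < h r) :
    ContinuousOn (ricciDefect I (radialMetric I G) h Ghat) (J ×ˢ univ) := by
  have h_continuous : ContinuousOn (fun p : ℝ × N => h p.1) (J ×ˢ univ) :=
    hh.continuousOn.comp continuousOn_fst fun _ hp => hp.1
  have warped_continuous := (hGhat.sq_smul hh hpos).continuousOn_ricciRR hJ
  exact (h_continuous.pow 2).mul ((hG.continuousOn_ricciRR hJ).sub warped_continuous)

theorem continuousOn_shapeDefect (hJ : IsOpen J) (hG : IsMetricFamily I 1 J G)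
    (hh : ContDiffOn ℝ 1 h J) (hpos : ∀ r ∈ J, 0 < h r) :
    ContinuousOn (shapeDefect I G h) (J ×ˢ univ) := by
  have h_continuous : ContinuousOn (fun p : ℝ × N => h p.1) (J ×ˢ univ) :=
    hh.continuousOn.comp continuousOn_fst fun _ hp => hp.1
  have logDeriv_continuous : ContinuousOn (fun p : ℝ × N => deriv h p.1 / h p.1) (J ×ˢ univ) :=
    ((hh.continuousOn_deriv_of_isOpen hJ le_rfl).comp continuousOn_fst fun _ hp => hp.1).div
      h_continuous fun p hp => (hpos p.1 hp.1).ne'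
  refine ((h_continuous.pow 2).mul (((hG.continuousOn_trace_weingarten_sq hJ).sub
    (((continuousOn_const (c := 2)).mul logDeriv_continuous).mul
      (hG.continuousOn_meanCurvature hJ))).add
    ((continuousOn_const (c := (d : ℝ))).mul (logDeriv_continuous.pow 2)))).congr fun p _ => ?_
  rw [shapeDefect, trace_sub_smul_one_sq, Fintype.card_fin]
  rfl

theorem shapeDefect_eq_zero_iff_exists_eq_sq_smul (hJ : IsOpen J) (hJ' : IsPreconnected J)
    (hJne : J.Nonempty) (hG : IsMetricFamily I 1 J G) (hh : DifferentiableOn ℝ h J)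
    (hpos : ∀ r ∈ J, 0 < h r) :
    (∀ p ∈ J ×ˢ univ, shapeDefect I G h p = 0) ↔
      ∃ Γ : BilinField I N, ∀ r ∈ J, ∀ x, G r x = h r ^ 2 • Γ x := by
  rw [← hG.weingarten_eq_iff_exists_eq_sq_smul hJ hJ' hJne hh hpos]
  exact ⟨fun h0 r hr x => (shapeDefect_eq_zero_iff hJ hG hr (hpos r hr).ne' x).1
      (h0 (r, x) ⟨hr, mem_univ x⟩),
    fun hW p hp => (shapeDefect_eq_zero_iff hJ hG hp.1 (hpos p.1 hp.1).ne' p.2).2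
      (hW p.1 hp.1 p.2)⟩

end RadialMassDerivative

/-! ### Asymptotic metrics -/

section Asymptotic

variable {d : ℕ} {H : Type*} [TopologicalSpace H]
  {I : ModelWithCorners ℝ (EuclideanSpace ℝ (Fin d)) H}
  {N : Type*} [TopologicalSpace N] [ChartedSpace H N]
  {G : ℝ → BilinField I N} {Ghat : BilinField I N} {h : ℝ → ℝ}

theorem radialMetric_eq_warpedMetric_iff (p : ℝ × N) :
    radialMetric I G p = warpedMetric I h Ghat p ↔ G p.1 p.2 = h p.1 ^ 2 • Ghat p.2 := by
  refine ⟨fun heq => ContinuousLinearMap.ext fun v => ContinuousLinearMap.ext fun w => ?_,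
    fun heq => congrArg radialForm heq⟩
  have apply_eq := congrArg (fun γ : (ℝ × EuclideanSpace ℝ (Fin d)) →L[ℝ]
    (ℝ × EuclideanSpace ℝ (Fin d)) →L[ℝ] ℝ => γ (0, v) (0, w)) heq
  exact add_left_cancel apply_eq

variable {k : WithTop ℕ∞} {a b r₀ : EReal}

-- By homogeneity the norm of `h² Γ - h² Ĝ` with respect to `h² Ĝ` does not depend on `r`.
theorem eq_of_asymptoticAt (hab : a < b) (hr₀ : r₀ ∈ Icc a b)
    (hGhat : IsMetricFamily I k (realIoo a b) fun _ => Ghat) (hpos : ∀ r ∈ realIoo a b, 0 < h r)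
    {Γ : BilinField I N} (hG : ∀ r ∈ realIoo a b, ∀ x, G r x = h r ^ 2 • Γ x)
    (has : AsymptoticAt I a b r₀ G h Ghat) (x : N) : Γ x = Ghat x := by
  obtain ⟨s, hs⟩ := nonempty_realIoo hab
  have hsymm := hGhat.symm s hs x
  have hGhat_pos := hGhat.pos s hs x
  have tensorNorm_lt : ∀ ε > 0, tensorNorm (Ghat x) (Γ x - Ghat x) < ε := fun ε hε => by
    have := nhdsIoo_neBot hab hr₀
    obtain ⟨r, hr, hrJ⟩ := ((has ε hε).and (realIoo_mem_nhdsIoo a b r₀)).exists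
    have scaled_lt := hr x
    rw [hG r hrJ] at scaled_lt
    refine lt_of_eq_of_lt ?_ scaled_lt
    exact (tensorNorm_smul_smul hsymm hGhat_pos (pow_pos (hpos r hrJ) 2).ne' _).symm.trans
      (congrArg (tensorNorm _) (smul_sub (h r ^ 2) (Γ x) (Ghat x)))
  refine sub_eq_zero.1 ((tensorNorm_eq_zero_iff hsymm hGhat_pos).1 ?_)
  exact le_antisymm (le_of_forall_gt tensorNorm_lt) (Real.sqrt_nonneg _)

theorem exists_eq_sq_smul_iff_radialMetric_eq_warpedMetric (hab : a < b) (hr₀ : r₀ ∈ Icc a b)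
    (hGhat : IsMetricFamily I k (realIoo a b) fun _ => Ghat) (hpos : ∀ r ∈ realIoo a b, 0 < h r)
    (has : AsymptoticAt I a b r₀ G h Ghat) :
    (∃ Γ : BilinField I N, ∀ r ∈ realIoo a b, ∀ x, G r x = h r ^ 2 • Γ x) ↔
      ∀ p ∈ realIoo a b ×ˢ univ, radialMetric I G p = warpedMetric I h Ghat p := by
  refine ⟨fun ⟨Γ, hΓ⟩ p hp => ?_, fun heq => ⟨Ghat, fun r hr x => ?_⟩⟩
  · rw [radialMetric_eq_warpedMetric_iff, hΓ p.1 hp.1,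
      eq_of_asymptoticAt hab hr₀ hGhat hpos hΓ has]
  · exact (radialMetric_eq_warpedMetric_iff (r, x)).1 (heq (r, x) ⟨hr, mem_univ x⟩)

end Asymptotic

/-! ### Smooth metrics -/

section SmoothMetrics

variable {d : ℕ} {H : Type*} [TopologicalSpace H]
  {I : ModelWithCorners ℝ (EuclideanSpace ℝ (Fin d)) H}
  {N : Type*} [TopologicalSpace N] [ChartedSpace H N] [IsManifold I ∞ N]

theorem SmoothMetricOn.isMetricFamily {J : Set ℝ} {G : ℝ → Metric I N}
    (hG : SmoothMetricOn I (radialMetric I fun r => (G r).inner) (J ×ˢ univ)) :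
    IsMetricFamily I ∞ J fun r => (G r).inner where
  contDiff x₀ i j := by
    have coordMatrix_contDiff :=
      contDiffOn_coordMatrix (b := radialBasis d) hG (0, x₀) (Sum.inr i) (Sum.inr j)
    refine (coordMatrix_contDiff.mono fun z hz => ⟨?_, hz.1, mem_univ _⟩).congr fun z hz => ?_
    · rw [extChartAt_prod, extChartAt_model_space_eq_id]
      exact ⟨mem_univ _, hz.2⟩
    · rw [coordMatrix_radial (p := (0, x₀)) hz.2, Matrix.fromBlocks_apply₂₂]
  symm r _ := (G r).symm
  pos r _ := (G r).pos

theorem isMetricFamily_const (γ : Metric I N) (J : Set ℝ) :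
    IsMetricFamily I ∞ J fun _ => γ.inner where
  contDiff x₀ i j := (contDiffOn_coordMatrix (b := stdBasis d)
    (γ.contMDiff.contMDiffOn (s := univ)) x₀ i j).comp contDiffOn_snd
      fun _ hz => ⟨hz.2, mem_univ _⟩
  symm _ _ := γ.symm
  pos _ _ := γ.pos

/-- The metric `c γ`, for `c > 0`. -/
def scaleMetric (c : ℝ) (hc : 0 < c) (γ : Metric I N) : Metric I N where
  inner x := c • γ.inner x
  symm x v w := congrArg (c * ·) (γ.symm x v w)
  pos x v hv := mul_pos hc (γ.pos x v hv)
  isVonNBounded x := by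
    refine Bornology.IsVonNBounded.subset (fun v hv => ?_) <| (γ.isVonNBounded x).image
      ((√c)⁻¹ • ContinuousLinearMap.id ℝ (TangentSpace I x))
    refine ⟨√c • v, ?_, ?_⟩
    · have hv' : c * γ.inner x v v < 1 := hv
      simp only [mem_ofPred_eq, map_smul, smul_apply, smul_eq_mul]
      rwa [← mul_assoc, Real.mul_self_sqrt hc.le]
    · simp [smul_smul, (Real.sqrt_pos.2 hc).ne']
  contMDiff := contMDiff_const.smul_section γ.contMDiff

theorem exists_metric_eq_sq_smul_iff {J : Set ℝ} (hJ : J.Nonempty) {G : ℝ → Metric I N}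
    {h : ℝ → ℝ} (hpos : ∀ r ∈ J, 0 < h r) :
    (∃ Γ : Metric I N, ∀ r ∈ J, ∀ x, (G r).inner x = h r ^ 2 • Γ.inner x) ↔
      ∃ Γ : BilinField I N, ∀ r ∈ J, ∀ x, (G r).inner x = h r ^ 2 • Γ x := by
  obtain ⟨s, hs⟩ := hJ
  have hs_pos := pow_pos (hpos s hs) 2
  refine ⟨fun ⟨Γ, hΓ⟩ => ⟨Γ.inner, hΓ⟩, fun ⟨Γ, hΓ⟩ =>
    ⟨scaleMetric (h s ^ 2)⁻¹ (inv_pos.2 hs_pos) (G s), fun r hr x => ?_⟩⟩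
  have inner_eq : (h s ^ 2)⁻¹ • (G s).inner x = Γ x := by
    rw [hΓ s hs, inv_smul_smul₀ hs_pos.ne']
  exact (hΓ r hr x).trans (congrArg (h r ^ 2 • ·) inner_eq.symm)

end SmoothMetrics

end RadialMass

end

theorem theorem1p1_general {d : ℕ} {H : Type*} [TopologicalSpace H]
    (I : ModelWithCorners ℝ (EuclideanSpace ℝ (Fin d)) H)
    {N : Type*} [TopologicalSpace N] [ChartedSpace H N] [IsManifold I 1 N]
    [CompactSpace N] [MeasurableSpace N] [OpensMeasurableSpace N]
    (μ : Measure N) [IsFiniteMeasure μ] [μ.IsOpenPosMeasure] {a b : EReal} (hab : a < b)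
    {G : ℝ → RadialMass.BilinField I N}
    (hG : RadialMass.IsMetricFamily I 2 (RadialMass.realIoo a b) G)
    {h : ℝ → ℝ} (hh : ContDiffOn ℝ 2 h (RadialMass.realIoo a b))
    (hpos : ∀ r ∈ RadialMass.realIoo a b, 0 < h r)
    {Ghat : RadialMass.BilinField I N}
    (hGhat : RadialMass.IsMetricFamily I 2 (RadialMass.realIoo a b) fun _ => Ghat)
    {Ma Mb : ℝ}
    (hMa : Tendsto (fun r => ∫ x, RadialMass.radialMass I (RadialMass.radialMetric I G) h Ghat
      (r, x) ∂μ) (RadialMass.nhdsIoo a b a) (𝓝 Ma))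
    (hMb : Tendsto (fun r => ∫ x, RadialMass.radialMass I (RadialMass.radialMetric I G) h Ghat
      (r, x) ∂μ) (RadialMass.nhdsIoo a b b) (𝓝 Mb))
    (hint : IntegrableOn (RadialMass.ricciDefect I (RadialMass.radialMetric I G) h Ghat)
      (RadialMass.realIoo a b ×ˢ univ) (volume.prod μ)) :
    (Mb - Ma ≥ ∫ p in RadialMass.realIoo a b ×ˢ univ,
        RadialMass.ricciDefect I (RadialMass.radialMetric I G) h Ghat p ∂(volume.prod μ)) ∧
    (Mb - Ma = ∫ p in RadialMass.realIoo a b ×ˢ univ,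
        RadialMass.ricciDefect I (RadialMass.radialMetric I G) h Ghat p ∂(volume.prod μ) ↔
      ∃ Gtilde : RadialMass.BilinField I N, ∀ r ∈ RadialMass.realIoo a b, ∀ x : N,
        G r x = h r ^ 2 • Gtilde x) ∧
    (∀ r₀ ∈ Icc a b, RadialMass.AsymptoticAt I a b r₀ G h Ghat →
      (Mb - Ma = ∫ p in RadialMass.realIoo a b ×ˢ univ,
        RadialMass.ricciDefect I (RadialMass.radialMetric I G) h Ghat p ∂(volume.prod μ) ↔
        ∀ p ∈ RadialMass.realIoo a b ×ˢ (univ : Set N),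
          RadialMass.radialMetric I G p = RadialMass.warpedMetric I h Ghat p)) := by
  have hJ := RadialMass.isOpen_realIoo a b
  have hG₁ := hG.of_le one_le_two
  have hh₁ := hh.of_le one_le_two
  have mass_continuous :=
    RadialMass.continuousOn_radialMass hJ hG₁ (hGhat.of_le one_le_two) hh₁ hpos
  have ricci_continuous := RadialMass.continuousOn_ricciDefect hJ hG hGhat hh hpos
  have shape_continuous := RadialMass.continuousOn_shapeDefect hJ hG₁ hh₁ hpos
  have mass_deriv := fun r (hr : r ∈ RadialMass.realIoo a b) x =>
    RadialMass.hasDerivAt_radialMass hJ hG hGhat hh hpos hr x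
  have shape_nonneg : ∀ p ∈ RadialMass.realIoo a b ×ˢ univ, 0 ≤ RadialMass.shapeDefect I G h p :=
    fun p hp => RadialMass.shapeDefect_nonneg hJ hG hp.1 p.2
  have equality_iff := (RadialMass.sub_eq_setIntegral_iff mass_continuous ricci_continuous
    shape_continuous mass_deriv hMa hMb hint shape_nonneg hab).trans
    (RadialMass.shapeDefect_eq_zero_iff_exists_eq_sq_smul hJ
      (RadialMass.ordConnected_realIoo a b).isPreconnected (RadialMass.nonempty_realIoo hab) hG₁
      (hh₁.differentiableOn one_ne_zero) hpos)
  exact ⟨RadialMass.setIntegral_le_sub mass_continuous ricci_continuous shape_continuous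
      mass_deriv hMa hMb hint shape_nonneg hab,
    equality_iff, fun r₀ hr₀ has => equality_iff.trans
      (RadialMass.exists_eq_sq_smul_iff_radialMetric_eq_warpedMetric hab hr₀ hGhat hpos has)⟩

theorem theorem1p1 {n : ℕ} (hn : 2 ≤ n)
    {H : Type*} [TopologicalSpace H]
    (I : ModelWithCorners ℝ (EuclideanSpace ℝ (Fin (n - 1))) H)
    {N : Type*} [TopologicalSpace N] [ChartedSpace H N] [IsManifold I ∞ N]
    [CompactSpace N] [T2Space N] [MeasurableSpace N] [BorelSpace N]
    (a b : EReal) (hab : a < b)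
    -- the metric `g = dr² + G(r)` on `M = (a, b) × N`
    (G : ℝ → RadialMass.Metric I N)
    (hG : RadialMass.SmoothMetricOn I (RadialMass.radialMetric I fun r => (G r).inner)
      (RadialMass.realIoo a b ×ˢ univ))
    -- the background metric `g₀ = dr² + h(r)² Ĝ`
    (h : ℝ → ℝ) (hh : ContDiffOn ℝ ∞ h (RadialMass.realIoo a b))
    (hpos : ∀ r ∈ RadialMass.realIoo a b, 0 < h r)
    (Ghat : RadialMass.Metric I N)
    -- the limits of the mass at the two ends
    (Ma Mb : ℝ)
    (hMa : Tendsto (RadialMass.totalMass I (RadialMass.radialMetric I fun r => (G r).inner)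
      h Ghat.inner) (RadialMass.nhdsIoo a b a) (𝓝 Ma))
    (hMb : Tendsto (RadialMass.totalMass I (RadialMass.radialMetric I fun r => (G r).inner)
      h Ghat.inner) (RadialMass.nhdsIoo a b b) (𝓝 Mb))
    (hint : IntegrableOn
      (RadialMass.ricciDefect I (RadialMass.radialMetric I fun r => (G r).inner) h Ghat.inner)
      (RadialMass.realIoo a b ×ˢ univ)
      (volume.prod (RadialMass.riemannianMeasure I Ghat.inner))) :
    (Mb - Ma ≥ ∫ p in RadialMass.realIoo a b ×ˢ univ,
        RadialMass.ricciDefect I (RadialMass.radialMetric I fun r => (G r).inner) h Ghat.inner p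
          ∂(volume.prod (RadialMass.riemannianMeasure I Ghat.inner))) ∧
    (Mb - Ma = ∫ p in RadialMass.realIoo a b ×ˢ univ,
        RadialMass.ricciDefect I (RadialMass.radialMetric I fun r => (G r).inner) h Ghat.inner p
          ∂(volume.prod (RadialMass.riemannianMeasure I Ghat.inner)) ↔
      ∃ Gtilde : RadialMass.Metric I N, ∀ r ∈ RadialMass.realIoo a b, ∀ x : N,
        (G r).inner x = h r ^ 2 • Gtilde.inner x) ∧
    (∀ r₀ ∈ Icc a b, RadialMass.AsymptoticAt I a b r₀ (fun r => (G r).inner) h Ghat.inner →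
      (Mb - Ma = ∫ p in RadialMass.realIoo a b ×ˢ univ,
        RadialMass.ricciDefect I (RadialMass.radialMetric I fun r => (G r).inner) h Ghat.inner p
          ∂(volume.prod (RadialMass.riemannianMeasure I Ghat.inner)) ↔
        ∀ p ∈ RadialMass.realIoo a b ×ˢ (univ : Set N),
          RadialMass.radialMetric I (fun r => (G r).inner) p
            = RadialMass.warpedMetric I h Ghat.inner p)) := by
  obtain ⟨hge, heq, hasymp⟩ := theorem1p1_general I (RadialMass.riemannianMeasure I Ghat.inner) hab
    (hG.isMetricFamily.of_le (by norm_cast)) (hh.of_le (by norm_cast)) hpos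
    ((RadialMass.isMetricFamily_const Ghat _).of_le (by norm_cast)) hMa hMb hint
  exact ⟨hge, heq.trans (RadialMass.exists_metric_eq_sq_smul_iff
    (RadialMass.nonempty_realIoo hab) hpos).symm, hasymp⟩
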